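/- Let $k$ be a field and let $K_0(\mathcal V_k)$ be the Grothendieck ring of varieties over $k$ (generated by classes $[X]$ of separated schemes $X$ of finite type over $k$, with $[X]=[Y]$ if $X\cong Y$, $[X]=[Z]+[X\smallsetminus Z]$ for $Z\subseteq X$ closed, $[X\times_k Y]=[X][Y]$ and $[\operatorname{Spec}k]=1$). Put $\mathbb T=[\mathbb G_m]\in K_0(\mathcal V_k)$. A graph means a finite multigraph (loops and parallel edges are allowed; it need not be connected). For a graph $\Gamma$ with $n$ edges let $$\Psi_\Gamma=\sum_{F}\ \prod_{e\notin F}t_e$$ be its Kirchhoff polynomial, the sum running over the spanning forests $F$ of $\Gamma$ having the same connected components as $\Gamma$ (spanning trees, if $\Gamma$ is connected), and let $$\mathbb U(\Gamma)=[\mathbb A^n\smallsetminus\{\Psi_\Gamma=0\}]\in K_0(\mathcal V_k).$$ Let $e$ be an edge of $\Gamma$. Write $\Gamma\smallsetminus e$ for the deletion and $\Gamma/e$ for the contraction of $e$, and for $m\ge 0$ let $\Gamma_{me}$ be the graph obtained from $\Gamma$ by replacing $e$ by $m$ parallel edges with the same ends (so that $\Gamma_{0e}=\Gamma\smallsetminus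 e$ and $\Gamma_{1e}=\Gamma$). 1. If $e$ is a looping edge, then $$\sum_{m\ge 0}\mathbb U(\Gamma_{me})\,\frac{s^m}{m!}=e^{\mathbb T s}\,\mathbb U(\Gamma\smallsetminus e).$$ 2. If $e$ is a bridge, then $$\sum_{m\ge 0}\mathbb U(\Gamma_{me})\,\frac{s^m}{m!}=\left(\mathbb T\cdot\frac{e^{\mathbb T s}-e^{-s}}{\mathbb T+1}+s\,e^{\mathbb T s}+1\right)\mathbb U(\Gamma\smallsetminus e).$$ 3. If $e$ is neither a bridge nor a looping edge, then $$\sum_{m\ge 0}\mathbb U(\Gamma_{me})\,\frac{s^m}{m!}=\frac{e^{\mathbb T s}-e^{-s}}{\mathbb T+1}\,\mathbb U(\Gamma)+\frac{e^{\mathbb T s}+\mathbb T e^{-s}}{\mathbb T+1}\,\mathbb U(\Gamma\smallsetminus e)+\left(s\,e^{\mathbb T s}-\frac{e^{\mathbb T s}-e^{-s}}{\mathbb T+1}\right)\mathbb U(\Gamma/e).$$ Here the quotients by $\mathbb T+1$ are formed coefficientwise in $s$, by exact division of polynomials in an indeterminate $T$ which is then specialized to $\mathbb T$. The identities hold as identities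 of formal power series in $s$ over $\mathbb Q\otimes_{\mathbb Z}K_0(\mathcal V_k)$, and moreover hold coefficient by coefficient in $K_0(\mathcal V_k)$ itself: for every $m\ge0$, $\mathbb U(\Gamma_{me})$ equals $m!$ times the coefficient of $s^m$ on the right-hand side, read as an integral polynomial expression in $\mathbb T$ times the indicated classes. In particular, the banana graph consisting of two vertices joined by $m$ parallel edges has class $$\mathbb T\,\frac{\mathbb T^m-(-1)^m}{\mathbb T+1}+m\,\mathbb T^{m-1}\quad\text{for } m\ge 1,\qquad\text{and } 1 \text{ for } m=0.$$ -/

import Mathlib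

universe u v

open CategoryTheory AlgebraicGeometry
open scoped Graph TensorProduct Nat

/-! ### Multigraphs: bridges, loops, contraction, parallel edges, the Kirchhoff polynomial -/

namespace Graph

variable {α : Type v} {β : Type u}

/-- Two vertices are connected by a (possibly trivial) path of `G`. -/
def Reachable (G : Graph α β) (x y : α) : Prop := Relation.ReflTransGen G.Adj x y

/-- `e` is a bridge: its ends are no longer connected to each other once `e` is removed. -/
def IsBridge (G : Graph α β) (e : β) : Prop :=
  ∃ x y, G.IsLink e x y ∧ ¬ (G.deleteEdges {e}).Reachable x y

/-- `e` is a looping edge. -/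
def IsLoop (G : Graph α β) (e : β) : Prop := ∃ x, G.IsLoopAt e x

/-- The contraction `G / e`: the ends of `e` are identified and `e` is removed. -/
def contractEdge (G : Graph α β) (e : β) : Graph (Quot (G.IsLink e)) β :=
  (G.deleteEdges {e}).map (Quot.mk (G.IsLink e))

/-- The graph obtained from `G` by replacing the edge `e` by `m` parallel edges
(`Sum.inr i` for `i : Fin m`) joining the two ends of `e`; the edges `f ≠ e` of `G` are kept
as `Sum.inl f`. -/
def parallelEdge (G : Graph α β) (e : β) (m : ℕ) : Graph α (β ⊕ Fin m) where
  vertexSet := V(G)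
  IsLink f x y := Sum.elim (fun g => g ≠ e ∧ G.IsLink g x y) (fun _ => G.IsLink e x y) f
  isLink_symm := by
    rintro (g | i) -
    · exact ⟨fun x y h => ⟨h.1, h.2.symm⟩⟩
    · exact ⟨fun x y h => Graph.IsLink.symm h⟩
  eq_or_eq_of_isLink_of_isLink := by
    rintro (g | i) x y z w h h'
    · exact h.2.left_eq_or_eq h'.2
    · exact Graph.IsLink.left_eq_or_eq h h'
  left_mem_of_isLink := by
    rintro (g | i) x y h
    · exact h.2.left_mem
    · exact Graph.IsLink.left_mem h

/-- `T` is the edge set of a spanning forest of `G` (of a spanning tree if `G` is connected):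
the spanning subgraph with edge set `T` connects all vertices that are connected in `G`, and it
is a forest, that is, all of its edges are bridges. -/
structure IsSpanningForest (G : Graph α β) (T : Set β) : Prop where
  subset : T ⊆ E(G)
  reachable : ∀ x y, G.Reachable x y → (G.restrict T).Reachable x y
  isBridge : ∀ f ∈ T, (G.restrict T).IsBridge f

/-- The Kirchhoff polynomial `Ψ_G = ∑_T ∏_{e ∉ T} t_e`, the sum over all spanning forests `T`,
in the variables `t_e` indexed by the edges of `G`. -/
noncomputable def kirchhoff (k : Type u) [CommRing k] (G : Graph α β) : MvPolynomial E(G) k :=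
  ∑ᶠ (T : Set β) (_ : G.IsSpanningForest T), ∏ᶠ (e : E(G)) (_ : (e : β) ∉ T), MvPolynomial.X e

instance finite_edgeSet_deleteEdges (G : Graph α β) [hG : Finite E(G)] (F : Set β) :
    Finite E(G.deleteEdges F) :=
  (Set.toFinite E(G)).subset Set.sdiff_subset

instance finite_edgeSet_contractEdge (G : Graph α β) [hG : Finite E(G)] (e : β) :
    Finite E(G.contractEdge e) :=
  (Set.toFinite E(G)).subset Set.sdiff_subset

instance finite_edgeSet_banana (x y : α) (F : Set β) [hF : Finite F] :
    Finite E(Graph.banana x y F) := hF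

instance finite_edgeSet_parallelEdge (G : Graph α β) [hG : Finite E(G)] (e : β) (m : ℕ) :
    Finite E(G.parallelEdge e m) := by
  refine (((Set.toFinite E(G)).image Sum.inl).union (Set.finite_range Sum.inr)).subset ?_
  rintro (g | i) ⟨x, y, h⟩
  · exact Or.inl ⟨g, h.2.edge_mem, rfl⟩
  · exact Or.inr ⟨i, rfl⟩

end Graph

/-! ### The Grothendieck ring of varieties -/

/-- Varieties over `k`: separated schemes of finite type over `k`. -/
structure Variety (k : Type u) [Field k] where
  toOver : Over (Spec (CommRingCat.of k))
  isSeparated : IsSeparated toOver.hom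
  locallyOfFiniteType : LocallyOfFiniteType toOver.hom
  quasiCompact : QuasiCompact toOver.hom

namespace Variety

variable (k : Type u) [Field k]

/-- The defining relations of the Grothendieck ring of varieties: isomorphic varieties are
identified, `[X] = [Z] + [X ∖ Z]` for `Z` closed in `X`, the product is the fibre product
over `k`, and the class of the point `Spec k` is `1`. -/
inductive IsRelation : FreeCommRing (Variety k) → Prop
  | iso (X Y : Variety k) (i : X.toOver ≅ Y.toOver) :
      IsRelation (FreeCommRing.of X - FreeCommRing.of Y)
  | scissor (X Z U : Variety k) (i : Z.toOver ⟶ X.toOver) (j : U.toOver ⟶ X.toOver)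
      (hi : IsClosedImmersion i.left) (hj : IsOpenImmersion j.left)
      (h : Set.range j.left = (Set.range i.left)ᶜ) :
      IsRelation (FreeCommRing.of X - (FreeCommRing.of Z + FreeCommRing.of U))
  | prod (X Y P : Variety k) (p : P.toOver ⟶ X.toOver) (q : P.toOver ⟶ Y.toOver)
      (h : IsPullback p.left q.left X.toOver.hom Y.toOver.hom) :
      IsRelation (FreeCommRing.of P - FreeCommRing.of X * FreeCommRing.of Y)
  | point (X : Variety k) (h : IsIso X.toOver.hom) :
      IsRelation (FreeCommRing.of X - 1)

/-- The Grothendieck ring of varieties `K₀(𝒱)` over `k`. -/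
abbrev K0 : Type (u + 1) :=
  FreeCommRing (Variety k) ⧸ Ideal.span {r | IsRelation k r}

variable {k}

/-- The class `[X]` of a variety in the Grothendieck ring. -/
noncomputable def cls (X : Variety k) : K0 k := Ideal.Quotient.mk _ (FreeCommRing.of X)

/-- The structure morphism of the affine space `𝔸^σ = Spec k[t_i : i ∈ σ]`. -/
noncomputable abbrev affineSpaceHom (k : Type u) [Field k] (σ : Type u) :
    Spec (CommRingCat.of (MvPolynomial σ k)) ⟶ Spec (CommRingCat.of k) :=
  Spec.map (CommRingCat.ofHom (algebraMap k (MvPolynomial σ k)))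

theorem locallyOfFiniteType_affineSpaceHom (σ : Type u) [Finite σ] :
    LocallyOfFiniteType (affineSpaceHom k σ) := by
  rw [HasRingHomProperty.Spec_iff (P := @LocallyOfFiniteType)]
  exact RingHom.finiteType_algebraMap.mpr inferInstance

/-- The open subscheme `{f ≠ 0}` of the affine space `𝔸^σ`. -/
noncomputable abbrev nonvanishing {σ : Type u} (f : MvPolynomial σ k) :
    (Spec (CommRingCat.of (MvPolynomial σ k))).Opens :=
  PrimeSpectrum.basicOpen f

theorem quasiCompact_comp {X Y : Scheme.{u}} [IsLocallyNoetherian X] (U : X.Opens) (g : X ⟶ Y)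
    [QuasiCompact g] : QuasiCompact (U.ι ≫ g) :=
  inferInstance

/-- The complement in the affine space `𝔸^σ` of the hypersurface `f = 0`, as a variety. -/
noncomputable def hypersurfaceComplement {σ : Type u} [Finite σ] (f : MvPolynomial σ k) :
    Variety k where
  toOver := Over.mk ((nonvanishing f).ι ≫ affineSpaceHom k σ)
  isSeparated := (inferInstance : IsSeparated ((nonvanishing f).ι ≫ affineSpaceHom k σ))
  locallyOfFiniteType :=
    have := locallyOfFiniteType_affineSpaceHom (k := k) σ
    (inferInstance : LocallyOfFiniteType ((nonvanishing f).ι ≫ affineSpaceHom k σ))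
  quasiCompact :=
    have : IsNoetherianRing (CommRingCat.of (MvPolynomial σ k)) :=
      (inferInstance : IsNoetherianRing (MvPolynomial σ k))
    quasiCompact_comp (nonvanishing f) (affineSpaceHom k σ)

variable (k)

/-- `𝕋 = [𝔾_m]`, the class of the multiplicative group `𝔸¹ ∖ {0}`. -/
noncomputable def torusClass : K0 k :=
  cls (hypersurfaceComplement (MvPolynomial.X PUnit.unit : MvPolynomial PUnit.{u + 1} k))

/-- `𝕌(G) = [𝔸ⁿ ∖ X̂_G]`, the class of the complement of the affine graph hypersurface
`Ψ_G = 0`, for a graph `G` with `n` edges. -/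
noncomputable def graphClass {α : Type v} {β : Type u} (G : Graph α β) [Finite E(G)] : K0 k :=
  cls (hypersurfaceComplement (G.kirchhoff k))

end Variety

/-! ### Exponential generating functions

Division by `𝕋 + 1` is carried out on polynomials in an indeterminate `T`, where it is exact,
before `T` is specialized to `𝕋`. -/

namespace ExpGen

open PowerSeries in
/-- The exponential generating function `∑_{m ≥ 0} a_m s^m / m!`, with coefficients in `R ⊗ ℚ`. -/
noncomputable def egf {R : Type v} [CommRing R] (a : ℕ → R) : (ℚ ⊗[ℤ] R)⟦X⟧ :=
  PowerSeries.mk fun m => ((m ! : ℚ)⁻¹) ⊗ₜ[ℤ] a m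

/-- The constant power series with value (the image of) `a`. -/
noncomputable def const {R : Type v} [CommRing R] (a : R) : PowerSeries (ℚ ⊗[ℤ] R) :=
  PowerSeries.C ((1 : ℚ) ⊗ₜ[ℤ] a)

/-- `e^{as}` as a formal power series in `s`. -/
noncomputable def expS {A : Type v} [CommRing A] [Algebra ℚ A] (a : A) : PowerSeries A :=
  PowerSeries.rescale a (PowerSeries.exp A)

/-- Specialization `T ↦ t` of a power series in `s` with coefficients in `ℚ[T]`. -/
noncomputable def spec {R : Type v} [CommRing R] (t : R) (f : PowerSeries (Polynomial ℚ)) :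
    PowerSeries (ℚ ⊗[ℤ] R) :=
  PowerSeries.map (Polynomial.aeval ((1 : ℚ) ⊗ₜ[ℤ] t)).toRingHom f

/-- Coefficientwise division by `T + 1` of a power series in `s` over `ℚ[T]`. -/
noncomputable def divTAddOne (f : PowerSeries (Polynomial ℚ)) : PowerSeries (Polynomial ℚ) :=
  PowerSeries.mk fun m => PowerSeries.coeff m f /ₘ (Polynomial.X + Polynomial.C 1)

/-- `(e^{Ts} - e^{-s}) / (T + 1)` -/
noncomputable def quotF : PowerSeries (Polynomial ℚ) :=
  divTAddOne (expS Polynomial.X - expS (-1))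

/-- `(e^{Ts} + T e^{-s}) / (T + 1)` -/
noncomputable def quotG : PowerSeries (Polynomial ℚ) :=
  divTAddOne (expS Polynomial.X + PowerSeries.C Polynomial.X * expS (-1))

/-- `(T^m - (-1)^m) / (T + 1)`, a polynomial with integer coefficients. -/
noncomputable def polyF (m : ℕ) : Polynomial ℤ :=
  (Polynomial.X ^ m - (-1) ^ m) /ₘ (Polynomial.X + Polynomial.C 1)

/-- `(T^m + (-1)^m T) / (T + 1)`, a polynomial with integer coefficients. -/
noncomputable def polyG (m : ℕ) : Polynomial ℤ :=
  (Polynomial.X ^ m + (-1) ^ m * Polynomial.X) /ₘ (Polynomial.X + Polynomial.C 1)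

/-- Division by `T + 1` is exact for polynomials vanishing at `-1`. -/
theorem mul_divByMonic_eq {A : Type v} [CommRing A] (p : Polynomial A) (h : p.eval (-1) = 0) :
    (Polynomial.X + Polynomial.C 1) * (p /ₘ (Polynomial.X + Polynomial.C 1)) = p := by
  have := Polynomial.mul_divByMonic_eq_iff_isRoot (p := p) (a := (-1 : A))
  rw [show (Polynomial.X - Polynomial.C (-1 : A)) = Polynomial.X + Polynomial.C 1 by simp] at this
  exact this.mpr h

theorem polyF_spec (m : ℕ) :
    (Polynomial.X + Polynomial.C 1) * polyF m = Polynomial.X ^ m - (-1) ^ m :=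
  mul_divByMonic_eq _ (by simp)

theorem polyG_spec (m : ℕ) :
    (Polynomial.X + Polynomial.C 1) * polyG m =
      Polynomial.X ^ m + (-1) ^ m * Polynomial.X :=
  mul_divByMonic_eq _ (by simp)

theorem quotF_spec :
    PowerSeries.C (Polynomial.X + Polynomial.C 1) * quotF =
      expS Polynomial.X - expS (-1) := by
  ext1 m
  rw [PowerSeries.coeff_C_mul, quotF, divTAddOne, PowerSeries.coeff_mk]
  refine mul_divByMonic_eq _ ?_
  simp [expS, PowerSeries.coeff_rescale, PowerSeries.coeff_exp]
  ring

theorem quotG_spec :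
    PowerSeries.C (Polynomial.X + Polynomial.C 1) * quotG =
      expS Polynomial.X + PowerSeries.C Polynomial.X * expS (-1) := by
  ext1 m
  rw [PowerSeries.coeff_C_mul, quotG, divTAddOne, PowerSeries.coeff_mk]
  refine mul_divByMonic_eq _ ?_
  simp [expS, PowerSeries.coeff_rescale, PowerSeries.coeff_exp]
  ring

end ExpGen

/-!
In a graph with `m > 0` parallel copies of `e`, a spanning forest contains at most one of the
copies. Hence its Kirchhoff polynomial is `∏ t_i · a + (∑ᵢ ∏_{j ≠ i} t_j) · b`
(`Variety.parallelPoly`), where `t_i` are the variables of the copies, `a` collects the spanning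
forests of the original graph avoiding `e` and `b` those through `e`. If `e` is not a bridge, `a`
is the Kirchhoff polynomial of the deletion; if `e` is not a loop, `b` is that of the contraction;
for a bridge `a = 0` and `b` is that of the deletion; for a loop `b = 0`. These facts are proved in
the lattice of equivalence relations on the vertices: an edge spans the relation identifying its
ends, spanning forests are the bases of this family (`Graph.isSpanningForest_iff`), and everything
follows from the exchange property (`Graph.exchange_linkSetoid`).

The class of the complement of such a polynomial is computed for arbitrary `a`, `b` in a finitely
generated `k`-algebra `A`, by adding one variable `t` at a time, which replaces `(a, b)` by
`(a t + b, b t)`. The hypersurface `a t + b = 0` in the line bundle `𝔸¹ × Spec A` is a graph over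
`{a ≠ 0}`, is all of `𝔸¹ × {a = b = 0}` over the common zeros, and is empty elsewhere. Writing
`U(f) = [{f ≠ 0}]` (`Variety.complClass`), this gives
* `U(a t + b) = 𝕋 U(a) + (𝕋 + 1) (U(b) - U(a b))` (`Variety.complClass_linear`),
* `U(b t) = 𝕋 U(b)` (`Variety.complClass_C_mul_X`),
* `U((a t + b) b t) = 𝕋 U(b) - U(a b)` (`Variety.complClass_linear_mul`), because on the graph
  `a t = - b` the condition `b t ≠ 0` says the same as `a b ≠ 0`.

The resulting linear recursion is solved in `Variety.complClass_parallelPoly`; no division by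
`𝕋 + 1` in the Grothendieck ring is needed. All varieties involved are affine, and the geometric
input is the scissor relation for a basic open subset together with
`Variety.complClass_eq_of_localization`. The generating functions restate the coefficientwise
identities, through `ExpGen.spec_polyEgf_mul_const`.
-/

/-! ### Classes of affine varieties and of basic open subsets -/

namespace Variety

section Affine

variable (k : Type u) [Field k] (A : Type u) [CommRing A] [Algebra k A] [Algebra.FiniteType k A]

/-- The affine variety `Spec A` of a finitely generated `k`-algebra `A`. -/
noncomputable def affine : Variety k where
  toOver := Over.mk (Spec.map (CommRingCat.ofHom (algebraMap k A)))
  isSeparated := (inferInstance : IsSeparated (Spec.map (CommRingCat.ofHom (algebraMap k A))))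
  locallyOfFiniteType := by
    change LocallyOfFiniteType (Spec.map (CommRingCat.ofHom (algebraMap k A)))
    rw [HasRingHomProperty.Spec_iff (P := @LocallyOfFiniteType)]
    exact RingHom.finiteType_algebraMap.mpr inferInstance
  quasiCompact := (inferInstance : QuasiCompact (Spec.map (CommRingCat.ofHom (algebraMap k A))))

/-- The class `[{f ≠ 0}]` of the basic open subset of `Spec A` on which `f` does not vanish,
encoded as the difference `[Spec A] - [Spec A/f]`. -/
noncomputable def complClass (f : A) : K0 k :=
  cls (affine k A) - cls (affine k (A ⧸ Ideal.span {f}))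

variable {k A}
variable {B : Type u} [CommRing B] [Algebra k B] [Algebra.FiniteType k B]

theorem mk_eq_zero_of_isRelation {r : FreeCommRing (Variety k)} (h : IsRelation k r) :
    Ideal.Quotient.mk (Ideal.span {r | IsRelation k r}) r = 0 :=
  Ideal.Quotient.eq_zero_iff_mem.mpr (Ideal.subset_span h)

theorem cls_eq_of_iso {X Y : Variety k} (i : X.toOver ≅ Y.toOver) : cls X = cls Y := by
  simpa only [cls, map_sub, sub_eq_zero] using mk_eq_zero_of_isRelation (IsRelation.iso X Y i)

theorem cls_eq_add {X Z U : Variety k} (i : Z.toOver ⟶ X.toOver) (j : U.toOver ⟶ X.toOver)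
    (hi : IsClosedImmersion i.left) (hj : IsOpenImmersion j.left)
    (h : Set.range j.left = (Set.range i.left)ᶜ) : cls X = cls Z + cls U := by
  simpa only [cls, map_sub, map_add, sub_eq_zero] using
    mk_eq_zero_of_isRelation (IsRelation.scissor X Z U i j hi hj h)

theorem cls_eq_mul {X Y P : Variety k} (p : P.toOver ⟶ X.toOver) (q : P.toOver ⟶ Y.toOver)
    (h : IsPullback p.left q.left X.toOver.hom Y.toOver.hom) : cls P = cls X * cls Y := by
  simpa only [cls, map_sub, map_mul, sub_eq_zero] using
    mk_eq_zero_of_isRelation (IsRelation.prod X Y P p q h)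

theorem cls_eq_one {X : Variety k} (h : IsIso X.toOver.hom) : cls X = 1 := by
  simpa only [cls, map_sub, map_one, sub_eq_zero] using
    mk_eq_zero_of_isRelation (IsRelation.point X h)

/-- The morphism of `k`-schemes induced by a homomorphism of `k`-algebras. -/
noncomputable def affineMap (θ : A →ₐ[k] B) : (affine k B).toOver ⟶ (affine k A).toOver :=
  Over.homMk (Spec.map (CommRingCat.ofHom (θ : A →+* B))) (by
    simp only [affine, Over.mk_left, Over.mk_hom]
    rw [← Spec.map_comp, ← CommRingCat.ofHom_comp, AlgHom.comp_algebraMap])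

theorem affineMap_comp {C : Type u} [CommRing C] [Algebra k C] [Algebra.FiniteType k C]
    (θ : A →ₐ[k] B) (η : B →ₐ[k] C) : affineMap η ≫ affineMap θ = affineMap (η.comp θ) := by
  ext1
  exact (Spec.map_comp (CommRingCat.ofHom (θ : A →+* B)) (CommRingCat.ofHom (η : B →+* C))).symm

theorem affineMap_id : affineMap (AlgHom.id k A) = 𝟙 _ := by
  ext1
  exact Spec.map_id (CommRingCat.of A)

theorem cls_affine_congr (θ : A ≃ₐ[k] B) : cls (affine k A) = cls (affine k B) := by
  refine cls_eq_of_iso ⟨affineMap (θ.symm : B →ₐ[k] A), affineMap (θ : A →ₐ[k] B), ?_, ?_⟩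
  · rw [affineMap_comp, AlgEquiv.symm_comp, affineMap_id]
  · rw [affineMap_comp, AlgEquiv.comp_symm, affineMap_id]

/-- Two quotients of the same algebra by the same ideal have the same class. -/
theorem cls_affine_eq_of_ker {R : Type u} [CommRing R] [Algebra k R]
    (θ : R →ₐ[k] A) (η : R →ₐ[k] B)
    (hθ : Function.Surjective θ) (hη : Function.Surjective η)
    (h : RingHom.ker θ = RingHom.ker η) : cls (affine k A) = cls (affine k B) :=
  cls_affine_congr ((Ideal.quotientKerAlgEquivOfSurjective hθ).symm.trans
    ((Ideal.quotientEquivAlgOfEq k h).trans (Ideal.quotientKerAlgEquivOfSurjective hη)))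

variable (k) in
theorem cls_affine_self : cls (affine k k) = 1 :=
  cls_eq_one (inferInstanceAs (IsIso (Spec.map (𝟙 (CommRingCat.of k)))))

theorem range_affineMap_mk (f : A) :
    Set.range (affineMap (Ideal.Quotient.mkₐ k (Ideal.span {f}))).left =
      (PrimeSpectrum.basicOpen f : Set (PrimeSpectrum A))ᶜ := by
  rw [PrimeSpectrum.basicOpen_eq_zeroLocus_compl, compl_compl, ← PrimeSpectrum.zeroLocus_span]
  refine (range_comap_of_surjective _ (Ideal.Quotient.mk (Ideal.span {f}))
    Ideal.Quotient.mk_surjective).trans ?_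
  rw [Ideal.mk_ker]

theorem isClosedImmersion_affineMap_mk (f : A) :
    IsClosedImmersion (affineMap (Ideal.Quotient.mkₐ k (Ideal.span {f}))).left :=
  IsClosedImmersion.spec_of_surjective _ Ideal.Quotient.mk_surjective

/-- `[{f ≠ 0}]` is the class of any open subscheme with the same points as `{f ≠ 0}`. -/
theorem complClass_eq_cls {f : A} {U : Variety k} (j : U.toOver ⟶ (affine k A).toOver)
    (hj : IsOpenImmersion j.left)
    (h : Set.range j.left = (PrimeSpectrum.basicOpen f : Set (PrimeSpectrum A))) :
    complClass k A f = cls U := by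
  rw [complClass, cls_eq_add (affineMap (Ideal.Quotient.mkₐ k (Ideal.span {f}))) j
    (isClosedImmersion_affineMap_mk f) hj
    (by rw [range_affineMap_mk, h]; exact (compl_compl _).symm)]
  ring

/-- The complement of a hypersurface of affine space, as a basic open subset. -/
theorem cls_hypersurfaceComplement {σ : Type u} [Finite σ] (f : MvPolynomial σ k) :
    cls (hypersurfaceComplement f) = complClass k (MvPolynomial σ k) f := by
  refine (complClass_eq_cls (U := hypersurfaceComplement f)
    (Over.homMk (nonvanishing f).ι rfl) ?_ ?_).symm
  · exact inferInstanceAs (IsOpenImmersion (nonvanishing f).ι)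
  · exact Scheme.Opens.range_ι _

/-- The class `[{f ≠ 0}]` depends on the set `{f ≠ 0}` only. -/
theorem complClass_eq_localization_of_basicOpen_eq {f g : A}
    (h : PrimeSpectrum.basicOpen f = PrimeSpectrum.basicOpen g) :
    complClass k A f = cls (affine k (Localization.Away g)) := by
  refine complClass_eq_cls
    (affineMap (IsScalarTower.toAlgHom k A (Localization.Away g))) ?_ ?_
  · exact inferInstanceAs (IsOpenImmersion
      (Spec.map (CommRingCat.ofHom (algebraMap A (Localization.Away g)))))
  · rw [h]
    exact PrimeSpectrum.localization_away_comap_range _ g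

theorem complClass_eq_localization (f : A) :
    complClass k A f = cls (affine k (Localization.Away f)) :=
  complClass_eq_localization_of_basicOpen_eq rfl

theorem complClass_eq_of_basicOpen_eq {f g : A}
    (h : PrimeSpectrum.basicOpen f = PrimeSpectrum.basicOpen g) :
    complClass k A f = complClass k A g := by
  rw [complClass_eq_localization_of_basicOpen_eq h, complClass_eq_localization]

/-- If `θ : A → B` becomes an isomorphism after inverting `f`, then the basic open subsets of
`f` and `θ f` have the same class. The hypotheses `hinj` and `hsurj` say that the induced map
`A_f → B_{θ f}` is injective and surjective. -/
theorem complClass_eq_of_localization (θ : A →ₐ[k] B) (f : A)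
    (hinj : ∀ x, θ x = 0 → ∃ n : ℕ, f ^ n * x = 0)
    (hsurj : ∀ y, ∃ (n : ℕ) (x : A), θ x = θ f ^ n * y) :
    complClass k A f = complClass k B (θ f) := by
  rw [complClass_eq_localization, complClass_eq_localization]
  let η : Localization.Away f →ₐ[k] Localization.Away (θ f) :=
    IsLocalization.Away.mapₐ (Localization.Away f) (Localization.Away (θ f)) θ f
  have hη (x : A) : η (algebraMap _ _ x) = algebraMap _ _ (θ x) := by
    simp [η, IsLocalization.Away.map]
  refine cls_affine_congr (AlgEquiv.ofBijective η ⟨?_, ?_⟩)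
  · rw [injective_iff_map_eq_zero]
    intro z hz
    obtain ⟨n, x, hx⟩ := IsLocalization.Away.surj f z
    have h1 : algebraMap B (Localization.Away (θ f)) (θ x) = 0 := by
      rw [← hη, ← hx, map_mul, hz, zero_mul]
    obtain ⟨⟨_, m, rfl⟩, hm⟩ := (IsLocalization.map_eq_zero_iff
      (Submonoid.powers (θ f)) (Localization.Away (θ f)) (θ x)).mp h1
    obtain ⟨l, hl⟩ := hinj (f ^ m * x) (by simpa using hm)
    have h2 : algebraMap A (Localization.Away f) x = 0 := by
      refine (IsLocalization.map_eq_zero_iff (Submonoid.powers f) _ x).mpr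
        ⟨⟨f ^ (l + m), l + m, rfl⟩, ?_⟩
      change f ^ (l + m) * x = 0
      rw [pow_add, mul_assoc, hl]
    rw [h2] at hx
    exact ((IsLocalization.Away.algebraMap_isUnit f).pow n).mul_left_eq_zero.mp hx
  · intro z
    obtain ⟨n, y, hy⟩ := IsLocalization.Away.surj (θ f) z
    obtain ⟨m, x, hx⟩ := hsurj y
    have hu : IsUnit (algebraMap A (Localization.Away f) f) :=
      IsLocalization.Away.algebraMap_isUnit f
    refine ⟨algebraMap _ _ x * ↑((hu.unit⁻¹) ^ (m + n)), ?_⟩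
    have hu' : IsUnit (algebraMap B (Localization.Away (θ f)) (θ f)) :=
      IsLocalization.Away.algebraMap_isUnit _
    refine (hu'.pow (m + n)).mul_left_inj.mp ?_
    have h3 : algebraMap B (Localization.Away (θ f)) (θ f) = η (algebraMap _ _ f) := (hη f).symm
    have h4 : (↑((hu.unit⁻¹) ^ (m + n)) : Localization.Away f) *
        algebraMap _ _ f ^ (m + n) = 1 := by
      rw [Units.val_pow_eq_pow_val, ← mul_pow, IsUnit.val_inv_mul, one_pow]
    nth_rewrite 1 [h3]
    rw [← map_pow, ← map_mul, mul_assoc, h4, mul_one, hη, hx, map_mul, map_pow, pow_add, ← hy]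
    ring

theorem complClass_congr (θ : A ≃ₐ[k] B) (f : A) : complClass k A f = complClass k B (θ f) :=
  complClass_eq_of_localization θ.toAlgHom f (fun x hx => ⟨0, by simpa using hx⟩)
    (fun y => ⟨0, θ.symm y, by simp⟩)

theorem complClass_zero : complClass k A 0 = 0 := by
  rw [complClass, sub_eq_zero]
  refine cls_affine_eq_of_ker (AlgHom.id k A) (Ideal.Quotient.mkₐ k _) Function.surjective_id
    Ideal.Quotient.mk_surjective ?_
  ext x
  simp [RingHom.mem_ker, Ideal.Quotient.eq_zero_iff_mem]

theorem complClass_one : complClass k A 1 = cls (affine k A) := by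
  rw [complClass_eq_localization]
  exact (cls_affine_congr
    (IsLocalization.atOne A (Localization.Away (1 : A)) |>.restrictScalars k)).symm

/-- `[𝔸¹ × Spec A] = [𝔸¹] [Spec A]`. -/
theorem cls_affine_polynomial :
    cls (affine k (Polynomial A)) = cls (affine k (Polynomial k)) * cls (affine k A) := by
  refine cls_eq_mul (affineMap (Polynomial.mapAlgHom (Algebra.ofId k A)))
    (affineMap (IsScalarTower.toAlgHom k A (Polynomial A))) ?_
  algebraize [Polynomial.mapRingHom (algebraMap k A)]
  refine isPullback_SpecMap_of_isPushout _ _ _ _ ?_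
  exact CommRingCat.isPushout_of_isPushout k (Polynomial k) A (Polynomial A)

variable (k) in
theorem torusClass_add_one : torusClass k + 1 = cls (affine k (Polynomial k)) := by
  have h : complClass k (Polynomial k) Polynomial.X =
      cls (affine k (Polynomial k)) - 1 := by
    rw [complClass, ← cls_affine_self k]
    congr 1
    refine (cls_affine_eq_of_ker (Ideal.Quotient.mkₐ k _) (Polynomial.aeval (0 : k))
      Ideal.Quotient.mk_surjective (fun x => ⟨Polynomial.C x, by simp⟩) ?_)
    ext p
    rw [RingHom.mem_ker, Ideal.Quotient.mkₐ_eq_mk, Ideal.Quotient.eq_zero_iff_mem,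
      Ideal.mem_span_singleton, Polynomial.X_dvd_iff, RingHom.mem_ker,
      Polynomial.coeff_zero_eq_aeval_zero]
  rw [torusClass, cls_hypersurfaceComplement,
    complClass_congr (MvPolynomial.uniqueAlgEquiv k PUnit)]
  have hX : MvPolynomial.uniqueAlgEquiv k PUnit.{u + 1} (MvPolynomial.X PUnit.unit) =
      Polynomial.X := by
    exact MvPolynomial.eval₂_X _ _ _
  rw [hX, h, sub_add_cancel]

end Affine

end Variety

/-! ### The complement of a hypersurface that is linear in one variable -/

namespace Variety

section Recursion

variable {k : Type u} [Field k] {A : Type u} [CommRing A] [Algebra k A] [Algebra.FiniteType k A]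

theorem ker_mkₐ_comp_mkₐ {R : Type u} [CommRing R] [Algebra k R] (a b : R) :
    RingHom.ker ((Ideal.Quotient.mkₐ k (Ideal.span {Ideal.Quotient.mk (Ideal.span {a}) b})).comp
      (Ideal.Quotient.mkₐ k (Ideal.span {a}))) = Ideal.span {a} ⊔ Ideal.span {b} := by
  have h : RingHom.ker
      ((Ideal.Quotient.mkₐ k (Ideal.span {Ideal.Quotient.mk (Ideal.span {a}) b})).comp
      (Ideal.Quotient.mkₐ k (Ideal.span {a}))) = Ideal.comap (Ideal.Quotient.mk (Ideal.span {a}))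
        (Ideal.map (Ideal.Quotient.mk (Ideal.span {a})) (Ideal.span {b})) := by
    rw [Ideal.map_span, Set.image_singleton]
    ext x
    rw [RingHom.mem_ker, Ideal.mem_comap, ← Ideal.Quotient.eq_zero_iff_mem]
    rfl
  rw [h, Ideal.comap_map_of_surjective _ Ideal.Quotient.mk_surjective, sup_comm]
  congr 1
  exact Ideal.mk_ker

theorem mkₐ_comp_mkₐ_surjective {R : Type u} [CommRing R] [Algebra k R] (a b : R) :
    Function.Surjective
      ((Ideal.Quotient.mkₐ k (Ideal.span {Ideal.Quotient.mk (Ideal.span {a}) b})).comp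
      (Ideal.Quotient.mkₐ k (Ideal.span {a}))) :=
  Ideal.Quotient.mk_surjective.comp Ideal.Quotient.mk_surjective

/-- The locus `{a = 0, b ≠ 0}` is the complement of `{a * b ≠ 0}` in `{b ≠ 0}`. -/
theorem complClass_quotient (a b : A) :
    complClass k (A ⧸ Ideal.span {a}) (Ideal.Quotient.mk _ b) =
      complClass k A b - complClass k A (a * b) := by
  have hle : Ideal.span {a * b} ≤ Ideal.span {a} :=
    Ideal.span_singleton_le_span_singleton.mpr (dvd_mul_right a b)
  -- `V(ab)` and `V(a)` agree where `b` is invertible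
  have h1 : complClass k (A ⧸ Ideal.span {a * b}) (Ideal.Quotient.mk _ b) =
      complClass k (A ⧸ Ideal.span {a}) (Ideal.Quotient.mk _ b) := by
    refine complClass_eq_of_localization (Ideal.Quotient.factorₐ k hle) _ ?_ ?_
    · intro x hx
      obtain ⟨x, rfl⟩ := Ideal.Quotient.mk_surjective x
      obtain ⟨c, rfl⟩ := Ideal.mem_span_singleton.mp (Ideal.Quotient.eq_zero_iff_mem.mp hx)
      refine ⟨1, ?_⟩
      rw [pow_one, ← map_mul, Ideal.Quotient.eq_zero_iff_mem, Ideal.mem_span_singleton]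
      exact ⟨c, by ring⟩
    · intro y
      obtain ⟨y, rfl⟩ := Ideal.Quotient.mk_surjective y
      exact ⟨0, Ideal.Quotient.mk _ y, by simp⟩
  have h2 : cls (affine k ((A ⧸ Ideal.span {a * b}) ⧸
      Ideal.span {Ideal.Quotient.mk (Ideal.span {a * b}) b})) =
      cls (affine k (A ⧸ Ideal.span {b})) := by
    refine cls_affine_eq_of_ker _ (Ideal.Quotient.mkₐ k (Ideal.span {b}))
      (mkₐ_comp_mkₐ_surjective (a * b) b) Ideal.Quotient.mk_surjective ?_
    rw [ker_mkₐ_comp_mkₐ, sup_eq_right.mpr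
      (Ideal.span_singleton_le_span_singleton.mpr (dvd_mul_left b a))]
    exact Ideal.mk_ker.symm
  rw [← h1, complClass, h2, complClass, complClass]
  ring

open Polynomial in
/-- Where `a` is invertible, `a t + b = 0` is the graph of `t = - b / a`. -/
theorem complClass_eq_linear (a b c : A) :
    complClass k A (a * c) =
      complClass k (A[X] ⧸ Ideal.span {C a * X + C b}) (Ideal.Quotient.mk _ (C (a * c))) := by
  set I : Ideal A[X] := Ideal.span {C a * X + C b}
  have hI : Ideal.Quotient.mk I (C a) * Ideal.Quotient.mk I X = - Ideal.Quotient.mk I (C b) := by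
    rw [eq_neg_iff_add_eq_zero, ← map_mul, ← map_add]
    exact Ideal.Quotient.eq_zero_iff_mem.mpr (Ideal.mem_span_singleton_self _)
  refine complClass_eq_of_localization
    ((Ideal.Quotient.mkₐ k I).comp (IsScalarTower.toAlgHom k A A[X])) (a * c) ?_ ?_
  · intro x hx
    obtain ⟨q, hq⟩ := Ideal.mem_span_singleton.mp (Ideal.Quotient.eq_zero_iff_mem.mp hx)
    replace hq : C x = (C a * X + C b) * q := hq
    -- compare coefficients in `x = (a t + b) q`; those of `q` vanish above its degree
    have key (i : ℕ) : a ^ i * x = (-1) ^ i * b ^ (i + 1) * q.coeff i := by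
      induction i with
      | zero =>
        have := congrArg (coeff · 0) hq
        simpa [add_mul, mul_assoc] using this
      | succ i ih =>
        have := congrArg (coeff · (i + 1)) hq
        simp only [add_mul, mul_assoc, coeff_add, coeff_C_mul, coeff_X_mul, coeff_C_succ] at this
        rw [pow_succ', mul_assoc, ih]
        linear_combination (-(-1) ^ i * b ^ (i + 1)) * this
    refine ⟨q.natDegree + 1, ?_⟩
    have := key (q.natDegree + 1)
    rw [coeff_eq_zero_of_natDegree_lt (Nat.lt_succ_self _), mul_zero] at this
    rw [mul_pow, mul_right_comm, this, zero_mul]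
  · intro y
    obtain ⟨p, rfl⟩ := Ideal.Quotient.mk_surjective y
    simp only [AlgHom.comp_apply, IsScalarTower.coe_toAlgHom', algebraMap_eq,
      Ideal.Quotient.mkₐ_eq_mk]
    induction p using Polynomial.induction_on with
    | C x => exact ⟨0, x, by simp⟩
    | add p q hp hq =>
      obtain ⟨n, x, hx⟩ := hp
      obtain ⟨m, y, hy⟩ := hq
      refine ⟨n + m, (a * c) ^ m * x + (a * c) ^ n * y, ?_⟩
      simp only [map_add, map_mul, map_pow] at hx hy ⊢
      rw [hx, hy]
      ring
    | monomial j x ih =>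
      obtain ⟨n, y, hy⟩ := ih
      refine ⟨n + 1, - (y * c * b), ?_⟩
      simp only [map_neg, map_mul, map_pow] at hy ⊢
      rw [hy]
      linear_combination (-(Ideal.Quotient.mk I (C a) * Ideal.Quotient.mk I (C c)) ^ n *
        Ideal.Quotient.mk I (C x) * Ideal.Quotient.mk I X ^ j * Ideal.Quotient.mk I (C c)) * hI

open Polynomial in
/-- The hypersurface `a t + b = 0` is a graph over `{a ≠ 0}` and a trivial line bundle over
`{a = b = 0}`; this is read off on the complement. -/
theorem complClass_linear (a b : A) :
    complClass k A[X] (C a * X + C b) = torusClass k * complClass k A a +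
      (torusClass k + 1) * (complClass k A b - complClass k A (a * b)) := by
  have h1 := complClass_eq_linear (k := k) a b 1
  rw [mul_one] at h1
  -- over `{a = 0}` the hypersurface is the trivial line bundle on `{a = b = 0}`
  have h2 : cls (affine k ((A[X] ⧸ Ideal.span {C a * X + C b}) ⧸
      Ideal.span {Ideal.Quotient.mk (Ideal.span {C a * X + C b}) (C a)})) =
      cls (affine k (((A ⧸ Ideal.span {a}) ⧸
        Ideal.span {Ideal.Quotient.mk (Ideal.span {a}) b})[X])) := by
    refine cls_affine_eq_of_ker _ (Polynomial.mapAlgHom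
      ((Ideal.Quotient.mkₐ k (Ideal.span {Ideal.Quotient.mk (Ideal.span {a}) b})).comp
      (Ideal.Quotient.mkₐ k (Ideal.span {a})))) (mkₐ_comp_mkₐ_surjective _ _)
      (Polynomial.map_surjective _ (mkₐ_comp_mkₐ_surjective a b)) ?_
    rw [ker_mkₐ_comp_mkₐ]
    refine Eq.trans ?_ (Polynomial.ker_mapRingHom
      ((Ideal.Quotient.mkₐ k (Ideal.span {Ideal.Quotient.mk (Ideal.span {a}) b})).comp
      (Ideal.Quotient.mkₐ k (Ideal.span {a}))).toRingHom).symm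
    refine Eq.trans ?_ (congrArg (Ideal.map C) (ker_mkₐ_comp_mkₐ (k := k) a b)).symm
    rw [Ideal.map_sup, Ideal.map_span, Ideal.map_span, Set.image_singleton, Set.image_singleton]
    have ha : C a ∈ Ideal.span {C a} := Ideal.mem_span_singleton_self _
    refine le_antisymm (sup_le ?_ le_sup_left) (sup_le le_sup_right ?_)
    · rw [Ideal.span_singleton_le_iff_mem]
      exact add_mem (Ideal.mul_mem_right _ _ (Ideal.mem_sup_left ha))
        (Ideal.mem_sup_right (Ideal.mem_span_singleton_self _))
    · rw [Ideal.span_singleton_le_iff_mem]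
      refine (Ideal.add_mem_iff_right _ (Ideal.mul_mem_right X _ (Ideal.mem_sup_right ha))).mp ?_
      exact Ideal.mem_sup_left (Ideal.mem_span_singleton_self _)
  rw [cls_affine_polynomial, ← torusClass_add_one] at h2
  have h3 := cls_affine_polynomial (k := k) (A := A)
  rw [← torusClass_add_one] at h3
  rw [← complClass_quotient]
  simp only [complClass] at h1 ⊢
  linear_combination h3 + h1 - h2

open Polynomial in
theorem complClass_C_mul_X (b : A) :
    complClass k A[X] (C b * X) = torusClass k * complClass k A b := by
  have := complClass_linear (k := k) b 0
  rwa [mul_zero, complClass_zero, sub_zero, mul_zero, C_0, add_zero, add_zero] at this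

open Polynomial in
/-- On `a t + b = 0` the conditions `b t ≠ 0` and `a b ≠ 0` are equivalent. -/
theorem complClass_linear_mul (a b : A) :
    complClass k A[X] ((C a * X + C b) * (C b * X)) =
      torusClass k * complClass k A b - complClass k A (a * b) := by
  have h := complClass_quotient (k := k) (C a * X + C b) (C b * X)
  rw [complClass_C_mul_X] at h
  have h' : complClass k (A[X] ⧸ Ideal.span {C a * X + C b}) (Ideal.Quotient.mk _ (C b * X)) =
      complClass k A (a * b) := by
    rw [complClass_eq_linear (k := k) a b b]
    apply complClass_eq_of_basicOpen_eq
    set I : Ideal A[X] := Ideal.span {C a * X + C b}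
    have hI : Ideal.Quotient.mk I (C a) * Ideal.Quotient.mk I X = - Ideal.Quotient.mk I (C b) := by
      rw [eq_neg_iff_add_eq_zero, ← map_mul, ← map_add]
      exact Ideal.Quotient.eq_zero_iff_mem.mpr (Ideal.mem_span_singleton_self _)
    ext P
    have hP : Ideal.Quotient.mk I (C b) ∈ P.asIdeal ↔
        Ideal.Quotient.mk I (C a) ∈ P.asIdeal ∨ Ideal.Quotient.mk I X ∈ P.asIdeal := by
      rw [← P.isPrime.mul_mem_iff_mem_or_mem, hI, neg_mem_iff]
    simp only [map_mul, PrimeSpectrum.basicOpen_mul, TopologicalSpace.Opens.coe_inf,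
      Set.mem_inter_iff, SetLike.mem_coe, PrimeSpectrum.mem_basicOpen]
    tauto
  rw [← h', h]
  ring

end Recursion

/-! ### Adding parallel variables one at a time -/

section Parallel

variable {k : Type u} [Field k] {A : Type u} [CommRing A] [Algebra k A] [Algebra.FiniteType k A]

/-- The polynomial `∏ t_i · a + (∑ᵢ ∏_{j ≠ i} t_j) · b`: the Kirchhoff polynomial of a graph in
which an edge has been replaced by parallel edges with variables `t_i`, where `a` comes from the
deletion and `b` from the contraction of that edge. -/
noncomputable def parallelPoly (ι : Type) [Fintype ι] [DecidableEq ι] (a b : A) :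
    MvPolynomial ι A :=
  (∏ i, MvPolynomial.X i) * MvPolynomial.C a +
    (∑ i, ∏ j ∈ Finset.univ.erase i, MvPolynomial.X j) * MvPolynomial.C b

theorem finSuccEquiv_prod_X (m : ℕ) :
    MvPolynomial.finSuccEquiv A m (∏ i, MvPolynomial.X i) =
      Polynomial.C (∏ i, MvPolynomial.X i) * Polynomial.X := by
  rw [Fin.prod_univ_succ, map_mul, map_prod, MvPolynomial.finSuccEquiv_X_zero, map_prod, mul_comm]
  simp only [MvPolynomial.finSuccEquiv_X_succ]

theorem finSuccEquiv_sum_prod_X (m : ℕ) :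
    MvPolynomial.finSuccEquiv A m (∑ i, ∏ j ∈ Finset.univ.erase i, MvPolynomial.X j) =
      Polynomial.C (∑ i, ∏ j ∈ Finset.univ.erase i, MvPolynomial.X j) * Polynomial.X +
        Polynomial.C (∏ i, MvPolynomial.X i) := by
  rw [Fin.sum_univ_succ]
  have h0 : (Finset.univ.erase (0 : Fin (m + 1))) =
      Finset.univ.map (Fin.succEmb m) := by
    ext j
    simp [Fin.exists_succ_eq]
  have hs (i : Fin m) : (Finset.univ.erase i.succ) =
      Finset.cons 0 ((Finset.univ.erase i).map (Fin.succEmb m)) (by simp) := by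
    ext j
    refine Fin.cases ?_ (fun j => ?_) j
    · simp [(Fin.succ_ne_zero i).symm]
    · simp
  simp only [h0, hs, Finset.prod_cons, Finset.prod_map, Fin.coe_succEmb, map_add, map_sum, map_mul,
    map_prod, MvPolynomial.finSuccEquiv_X_zero, MvPolynomial.finSuccEquiv_X_succ, Finset.sum_mul]
  rw [add_comm]
  simp only [mul_comm]

theorem finSuccEquiv_parallelPoly (m : ℕ) (a b : A) :
    MvPolynomial.finSuccEquiv A m (parallelPoly (Fin (m + 1)) a b) =
      Polynomial.C (parallelPoly (Fin m) a b) * Polynomial.X +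
        Polynomial.C ((∏ i, MvPolynomial.X i) * MvPolynomial.C b) := by
  have hC (x : A) : MvPolynomial.finSuccEquiv A m (MvPolynomial.C x) =
      Polynomial.C (MvPolynomial.C x) := (MvPolynomial.finSuccEquiv A m).commutes x
  simp only [parallelPoly, map_add, map_mul, hC, finSuccEquiv_prod_X, finSuccEquiv_sum_prod_X]
  ring

theorem finSuccEquiv_prod_X_mul_C (m : ℕ) (b : A) :
    MvPolynomial.finSuccEquiv A m ((∏ i, MvPolynomial.X i) * MvPolynomial.C b) =
      Polynomial.C ((∏ i, MvPolynomial.X i) * MvPolynomial.C b) * Polynomial.X := by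
  have hC (x : A) : MvPolynomial.finSuccEquiv A m (MvPolynomial.C x) =
      Polynomial.C (MvPolynomial.C x) := (MvPolynomial.finSuccEquiv A m).commutes x
  simp only [map_mul, hC, finSuccEquiv_prod_X]
  ring

theorem parallelPoly_zero (a b : A) : parallelPoly (Fin 0) a b = MvPolynomial.C a := by
  simp [parallelPoly]

theorem complClass_C_of_isEmpty (a : A) :
    complClass k (MvPolynomial (Fin 0) A) (MvPolynomial.C a) = complClass k A a := by
  rw [complClass_congr ((MvPolynomial.isEmptyAlgEquiv A (Fin 0)).restrictScalars k)]
  congr 1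
  exact (MvPolynomial.isEmptyAlgEquiv A (Fin 0)).commutes a

theorem complClass_prod_X_mul_C (m : ℕ) (b : A) :
    complClass k (MvPolynomial (Fin m) A) ((∏ i, MvPolynomial.X i) * MvPolynomial.C b) =
      torusClass k ^ m * complClass k A b := by
  induction m with
  | zero => simp [complClass_C_of_isEmpty]
  | succ m ih =>
    rw [complClass_congr ((MvPolynomial.finSuccEquiv A m).restrictScalars k),
      AlgEquiv.restrictScalars_apply, finSuccEquiv_prod_X_mul_C, complClass_C_mul_X, ih]
    ring

theorem complClass_parallelPoly_succ (m : ℕ) (a b : A) :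
    complClass k (MvPolynomial (Fin (m + 1)) A) (parallelPoly (Fin (m + 1)) a b) =
      torusClass k * complClass k (MvPolynomial (Fin m) A) (parallelPoly (Fin m) a b) +
        (torusClass k + 1) * (torusClass k ^ m * complClass k A b -
          complClass k (MvPolynomial (Fin m) A)
            (parallelPoly (Fin m) a b * ((∏ i, MvPolynomial.X i) * MvPolynomial.C b))) := by
  rw [complClass_congr ((MvPolynomial.finSuccEquiv A m).restrictScalars k),
    AlgEquiv.restrictScalars_apply, finSuccEquiv_parallelPoly, complClass_linear,
    complClass_prod_X_mul_C]

theorem complClass_parallelPoly_mul_succ (m : ℕ) (a b : A) :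
    complClass k (MvPolynomial (Fin (m + 1)) A)
      (parallelPoly (Fin (m + 1)) a b * ((∏ i, MvPolynomial.X i) * MvPolynomial.C b)) =
      torusClass k ^ (m + 1) * complClass k A b - complClass k (MvPolynomial (Fin m) A)
            (parallelPoly (Fin m) a b * ((∏ i, MvPolynomial.X i) * MvPolynomial.C b)) := by
  rw [complClass_congr ((MvPolynomial.finSuccEquiv A m).restrictScalars k),
    AlgEquiv.restrictScalars_apply, map_mul, finSuccEquiv_parallelPoly, finSuccEquiv_prod_X_mul_C,
    complClass_linear_mul, complClass_prod_X_mul_C, pow_succ', mul_assoc]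

end Parallel

end Variety

/-! ### Solving the recursion -/

namespace ExpGen

theorem X_add_C_one_mul_cancel {R : Type v} [CommRing R] {p q : Polynomial R}
    (h : (Polynomial.X + Polynomial.C 1) * p = (Polynomial.X + Polynomial.C 1) * q) : p = q :=
  (Polynomial.monic_X_add_C (1 : R)).isRegular.left h

theorem polyF_zero : polyF 0 = 0 :=
  X_add_C_one_mul_cancel (by rw [polyF_spec]; simp)

theorem polyG_zero : polyG 0 = 1 :=
  X_add_C_one_mul_cancel (by rw [polyG_spec]; simp [add_comm])

theorem polyF_succ (m : ℕ) : polyF (m + 1) = Polynomial.X * polyF m + (-1) ^ m := by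
  refine X_add_C_one_mul_cancel ?_
  have := polyF_spec m
  rw [map_one] at this
  rw [polyF_spec, map_one]
  linear_combination -Polynomial.X * this

theorem polyG_succ (m : ℕ) :
    polyG (m + 1) = Polynomial.X * polyG m - (-1) ^ m * Polynomial.X := by
  refine X_add_C_one_mul_cancel ?_
  have := polyG_spec m
  rw [map_one] at this
  rw [polyG_spec, map_one]
  linear_combination -Polynomial.X * this

end ExpGen

namespace Variety

section Parallel

open ExpGen

variable {k : Type u} [Field k] {A : Type u} [CommRing A] [Algebra k A] [Algebra.FiniteType k A]

/-- The class of the complement of `∏ t_i · a + (∑ᵢ ∏_{j ≠ i} t_j) · b = 0`, in terms of the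
classes for zero and one variables. -/
theorem complClass_parallelPoly (m : ℕ) (a b : A) :
    complClass k (MvPolynomial (Fin m) A) (parallelPoly (Fin m) a b) =
      Polynomial.aeval (torusClass k) (polyF m) *
        complClass k (MvPolynomial (Fin 1) A) (parallelPoly (Fin 1) a b) +
      Polynomial.aeval (torusClass k) (polyG m) * complClass k A a +
      (m * torusClass k ^ (m - 1) - Polynomial.aeval (torusClass k) (polyF m)) *
        complClass k A b := by
  set N : ℕ → K0 k := fun m =>
    complClass k (MvPolynomial (Fin m) A) (parallelPoly (Fin m) a b) with hN
  -- `D m` is the class of the locus where `parallelPoly` vanishes and `∏ t_i · b` does not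
  set D : ℕ → K0 k := fun m => torusClass k ^ m * complClass k A b -
    complClass k (MvPolynomial (Fin m) A)
      (parallelPoly (Fin m) a b * ((∏ i, MvPolynomial.X i) * MvPolynomial.C b)) with hD
  have hN0 : N 0 = complClass k A a := by
    simp only [hN, parallelPoly_zero, complClass_C_of_isEmpty]
  have hNs (m : ℕ) : N (m + 1) = torusClass k * N m + (torusClass k + 1) * D m :=
    complClass_parallelPoly_succ m a b
  have hDs (m : ℕ) : D (m + 1) = torusClass k ^ m * complClass k A b - D m := by
    simp only [hD, complClass_parallelPoly_mul_succ]
    ring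
  have hD' (m : ℕ) : (torusClass k + 1) * D m = (-1) ^ m * (N 1 - torusClass k * N 0) +
      (torusClass k ^ m - (-1) ^ m) * complClass k A b := by
    induction m with
    | zero => rw [hNs 0]; ring
    | succ m ih => rw [hDs, mul_sub, ih]; ring
  rw [← hN0]
  change N m = _ * N 1 + _ + _
  induction m with
  | zero => simp [polyF_zero, polyG_zero]
  | succ m ih =>
    have hm : torusClass k * ((m : K0 k) * torusClass k ^ (m - 1)) = m * torusClass k ^ m := by
      cases m with
      | zero => simp
      | succ m => rw [Nat.add_sub_cancel]; ring
    rw [hNs, hD', ih, polyF_succ, polyG_succ]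
    simp only [map_add, map_sub, map_mul, map_pow, map_neg, map_one, Polynomial.aeval_X,
      Nat.cast_add, Nat.cast_one, Nat.add_sub_cancel]
    linear_combination complClass k A b * hm

end Parallel

end Variety

/-! ### Bases of families in a complete lattice -/

namespace LatticeBasis

variable {ι ι' L : Type*} [CompleteLattice L]

/-- `T ⊆ E` is a basis of the family `s` restricted to `E`: it has the same supremum, and no
member lies below the supremum of the others. -/
structure IsBasis (s : ι → L) (E T : Set ι) : Prop where
  subset : T ⊆ E
  le : ⨆ f ∈ E, s f ≤ ⨆ f ∈ T, s f
  indep : ∀ f ∈ T, ¬ s f ≤ ⨆ g ∈ T \ {f}, s g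

/-- The exchange property of a family, as enjoyed by families of atoms of a semimodular lattice. -/
def Exchange (s : ι → L) : Prop :=
  ∀ (r : L) (i j : ι), s i ≤ r ⊔ s j → ¬ s i ≤ r → s j ≤ r ⊔ s i

variable {s : ι → L} {E T : Set ι} {e : ι}

theorem iSup_mem_mono {S T : Set ι} (h : S ⊆ T) : ⨆ f ∈ S, s f ≤ ⨆ f ∈ T, s f :=
  biSup_mono fun _ hf => h hf

theorem iSup_mem_eq_sup (he : e ∈ E) : ⨆ f ∈ E, s f = s e ⊔ ⨆ f ∈ E \ {e}, s f := by
  rw [← iSup_insert, Set.insert_sdiff_singleton, Set.insert_eq_of_mem he]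

/-- Bases of a family pulled back along `π`, such as one with repeated members. -/
theorem isBasis_iff_image {s' : ι' → L} {π : ι' → ι} {E' T' : Set ι'}
    (hs : ∀ i ∈ E', s' i = s (π i)) (hT : T' ⊆ E') :
    IsBasis s' E' T' ↔ Set.InjOn π T' ∧ IsBasis s (π '' E') (π '' T') := by
  have hsup (S : Set ι') (hS : S ⊆ E') : ⨆ i ∈ S, s' i = ⨆ f ∈ π '' S, s f := by
    rw [iSup_image]
    exact biSup_congr fun i hi => hs i (hS hi)
  constructor
  · intro h
    have hinj : Set.InjOn π T' := by
      intro i hi j hj hij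
      by_contra hne
      refine h.indep i hi ?_
      rw [hs i (hT hi), hij, ← hs j (hT hj)]
      exact le_iSup₂_of_le j ⟨hj, fun h => hne h.symm⟩ le_rfl
    refine ⟨hinj, Set.image_mono hT, ?_, ?_⟩
    · rw [← hsup _ subset_rfl, ← hsup _ hT]
      exact h.le
    · rintro _ ⟨i, hi, rfl⟩ hle
      refine h.indep i hi ?_
      rw [hs i (hT hi), hsup _ (Set.sdiff_subset.trans hT), hinj.image_sdiff_subset
        (Set.singleton_subset_iff.mpr hi), Set.image_singleton]
      exact hle
  · rintro ⟨hinj, h⟩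
    refine ⟨hT, ?_, ?_⟩
    · rw [hsup _ subset_rfl, hsup _ hT]
      exact h.le
    · intro i hi hle
      refine h.indep (π i) ⟨i, hi, rfl⟩ ?_
      rw [hs i (hT hi), hsup _ (Set.sdiff_subset.trans hT), hinj.image_sdiff_subset
        (Set.singleton_subset_iff.mpr hi), Set.image_singleton] at hle
      exact hle

theorem IsBasis.mem_of_not_le (h : IsBasis s E T) (he : e ∈ E)
    (hb : ¬ s e ≤ ⨆ f ∈ E \ {e}, s f) : e ∈ T := by
  by_contra heT
  refine hb ((le_iSup₂_of_le e he le_rfl).trans (h.le.trans (iSup_mem_mono fun f hf => ?_)))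
  exact ⟨h.subset hf, fun hfe => heT (hfe ▸ hf)⟩

theorem IsBasis.notMem_of_eq_bot (h : IsBasis s E T) (he : s e = ⊥) : e ∉ T :=
  fun heT => h.indep e heT (he ▸ bot_le)

theorem isBasis_sdiff_iff_of_le (he : e ∈ E) (hb : s e ≤ ⨆ f ∈ E \ {e}, s f)
    (hT : T ⊆ E \ {e}) : IsBasis s (E \ {e}) T ↔ IsBasis s E T := by
  have hE : ⨆ f ∈ E, s f = ⨆ f ∈ E \ {e}, s f := by
    rw [iSup_mem_eq_sup he, sup_eq_right.mpr hb]
  exact ⟨fun h => ⟨hT.trans Set.sdiff_subset, hE.trans_le h.le, h.indep⟩,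
    fun h => ⟨hT, hE.symm.trans_le h.le, h.indep⟩⟩

/-- If `s e` is not spanned by the rest, as for a bridge, bases are those of the deletion together
with `e`. -/
theorem isBasis_insert_iff_of_not_le (hs : Exchange s) (he : e ∈ E)
    (hb : ¬ s e ≤ ⨆ f ∈ E \ {e}, s f) (hT : T ⊆ E \ {e}) :
    IsBasis s E (insert e T) ↔ IsBasis s (E \ {e}) T := by
  have heT : e ∉ T := fun h => (hT h).2 rfl
  have hbT : ¬ s e ≤ ⨆ f ∈ T, s f := fun h => hb (h.trans (iSup_mem_mono hT))
  constructor
  · intro h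
    refine ⟨hT, iSup₂_le fun f hf => ?_, fun f hf hle => ?_⟩
    · by_contra hfT
      have h1 : s f ≤ (⨆ g ∈ T, s g) ⊔ s e := by
        rw [sup_comm, ← iSup_insert]
        exact (le_iSup₂_of_le f hf.1 le_rfl).trans h.le
      refine hb ((hs _ _ _ h1 hfT).trans (sup_le (iSup_mem_mono hT) ?_))
      exact le_iSup₂_of_le f hf le_rfl
    · refine h.indep f (Set.mem_insert_of_mem e hf) (hle.trans (iSup_mem_mono ?_))
      exact Set.sdiff_subset_sdiff_left (Set.subset_insert e T)
  · intro h
    refine ⟨Set.insert_subset he (hT.trans Set.sdiff_subset), ?_, ?_⟩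
    · rw [iSup_mem_eq_sup he, iSup_insert]
      exact sup_le_sup_left h.le _
    · rintro f (rfl | hf) hle
      · rw [Set.insert_sdiff_self_of_notMem heT] at hle
        exact hbT hle
      · have hfe : f ≠ e := fun h => heT (h ▸ hf)
        rw [Set.insert_sdiff_of_notMem _ (fun h => hfe (Set.mem_singleton_iff.mp h).symm),
          iSup_insert, sup_comm] at hle
        have := hs _ _ _ hle (h.indep f hf)
        rw [sup_comm, ← iSup_mem_eq_sup hf] at this
        exact hbT this

/-- Bases containing `e` are the bases of the contraction by `e`. -/
theorem isBasis_insert_iff_of_ne_bot (hs : Exchange s) (he : e ∈ E) (hne : s e ≠ ⊥)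
    (hT : T ⊆ E \ {e}) (hfin : T.Finite) :
    IsBasis s E (insert e T) ↔
      (s e ⊔ ⨆ f ∈ E \ {e}, s f ≤ s e ⊔ ⨆ f ∈ T, s f) ∧
        ∀ f ∈ T, ¬ s f ≤ s e ⊔ ⨆ g ∈ T \ {f}, s g := by
  have heT : e ∉ T := fun h => (hT h).2 rfl
  have hins (f : ι) (hf : f ∈ T) :
      ⨆ g ∈ insert e T \ {f}, s g = s e ⊔ ⨆ g ∈ T \ {f}, s g := by
    have hef : e ∉ ({f} : Set ι) := fun h => heT (Set.mem_singleton_iff.mp h ▸ hf)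
    rw [Set.insert_sdiff_of_notMem _ hef, iSup_insert]
  constructor
  · intro h
    refine ⟨?_, fun f hf hle => h.indep f (Set.mem_insert_of_mem e hf) ?_⟩
    · rw [← iSup_mem_eq_sup he, ← iSup_insert]
      exact h.le
    · rwa [hins f hf]
  · rintro ⟨h1, h2⟩
    refine ⟨Set.insert_subset he (hT.trans Set.sdiff_subset), ?_, ?_⟩
    · rwa [iSup_mem_eq_sup he, iSup_insert]
    · rintro f (rfl | hf) hle
      · rw [Set.insert_sdiff_self_of_notMem heT] at hle
        -- a minimal subset of `T` spanning `s f` is nonempty; exchange one of its members with `f`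
        have hfin' : {S : Set ι | S ⊆ T ∧ s f ≤ ⨆ g ∈ S, s g}.Finite :=
          hfin.finite_subsets.subset fun S hS => hS.1
        obtain ⟨S, hST, hS⟩ := hfin'.exists_le_minimal ⟨subset_rfl, hle⟩
        obtain rfl | ⟨g, hg⟩ := S.eq_empty_or_nonempty
        · exact hne (le_bot_iff.mp (by simpa using hS.prop.2))
        · have h3 : ¬ s f ≤ ⨆ i ∈ S \ {g}, s i := fun h =>
            (hS.le_of_le ⟨Set.sdiff_subset.trans hST, h⟩ Set.sdiff_subset hg).2 rfl
          have h4 := hS.prop.2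
          rw [iSup_mem_eq_sup hg, sup_comm] at h4
          refine h2 g (hST hg) ((hs _ _ _ h4 h3).trans ?_)
          rw [sup_comm]
          exact sup_le_sup_left (iSup_mem_mono (Set.sdiff_subset_sdiff_left hST)) _
      · rw [hins f hf] at hle
        exact h2 f hf hle

end LatticeBasis

/-! ### Spanning forests as bases -/

namespace Graph

open LatticeBasis

variable {α : Type v} {β : Type u}

/-- The equivalence relation on vertices identifying the ends of `f`. It is trivial if `f` is a
loop, or not an edge of `G`. -/
def linkSetoid (G : Graph α β) (f : β) : Setoid α := Relation.EqvGen.setoid (G.IsLink f)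

variable {G : Graph α β} {e f : β} {x y : α}

theorem linkSetoid_le_iff {r : Setoid α} :
    G.linkSetoid f ≤ r ↔ ∀ x y, G.IsLink f x y → r x y :=
  ⟨fun h x y hxy => h (Relation.EqvGen.rel x y hxy), fun h => Setoid.eqvGen_le h⟩

theorem IsLink.linkSetoid_le_iff {r : Setoid α} (h : G.IsLink f x y) :
    G.linkSetoid f ≤ r ↔ r x y := by
  rw [Graph.linkSetoid_le_iff]
  refine ⟨fun h' => h' x y h, fun h' z w hzw => ?_⟩
  obtain ⟨rfl, rfl⟩ | ⟨rfl, rfl⟩ := h.eq_and_eq_or_eq_and_eq hzw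
  · exact h'
  · exact r.symm h'

/-- Joining the ends `u`, `v` of `f` only adds connections that pass through `f` once. -/
theorem IsLink.sup_linkSetoid {u v : α} (h : G.IsLink f u v) {r : Setoid α}
    (hxy : (r ⊔ G.linkSetoid f) x y) : r x y ∨ (r x u ∧ r v y) ∨ (r x v ∧ r u y) := by
  classical
  -- the map to the classes of `r` which sends the class of `v` to that of `u`
  let c : α → Quotient r := fun z =>
    if (Quotient.mk r z) = Quotient.mk r v then Quotient.mk r u else Quotient.mk r z
  have hle : r ⊔ G.linkSetoid f ≤ Setoid.ker c := by
    refine sup_le (fun z w hzw => ?_) (h.linkSetoid_le_iff.mpr ?_)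
    · have : Quotient.mk r z = Quotient.mk r w := Quotient.sound hzw
      simp [Setoid.ker_def, c, this]
    · by_cases huv : Quotient.mk r u = Quotient.mk r v <;> simp [Setoid.ker_def, c]
  have hc : c x = c y := hle hxy
  simp only [c] at hc
  split_ifs at hc with h1 h2 h2
  · exact Or.inl (r.trans (Quotient.exact h1) (r.symm (Quotient.exact h2)))
  · exact Or.inr (Or.inr ⟨Quotient.exact h1, Quotient.exact hc⟩)
  · exact Or.inr (Or.inl ⟨Quotient.exact hc, r.symm (Quotient.exact h2)⟩)
  · exact Or.inl (Quotient.exact hc)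

theorem exchange_linkSetoid (G : Graph α β) : Exchange G.linkSetoid := by
  intro r i j hij hi
  rw [Graph.linkSetoid_le_iff] at hi
  push Not at hi
  obtain ⟨x, y, hxy, hr⟩ := hi
  rw [Graph.linkSetoid_le_iff]
  intro u v huv
  have hle : r ≤ r ⊔ G.linkSetoid i := le_sup_left
  have hi' : (r ⊔ G.linkSetoid i) x y := hxy.linkSetoid_le_iff.mp le_sup_right
  rcases huv.sup_linkSetoid (hxy.linkSetoid_le_iff.mp hij) with h | ⟨h, h'⟩ | ⟨h, h'⟩
  · exact absurd h hr
  · exact Setoid.trans' _ (Setoid.symm' _ (hle h)) (Setoid.trans' _ hi' (Setoid.symm' _ (hle h')))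
  · exact Setoid.trans' _ (hle h') (Setoid.trans' _ (Setoid.symm' _ hi') (hle h))

theorem reachable_iff (G : Graph α β) (x y : α) :
    G.Reachable x y ↔ (⨆ f, G.linkSetoid f) x y := by
  constructor
  · intro h
    induction h with
    | refl => exact Setoid.refl' _ _
    | tail _ h ih =>
      obtain ⟨f, hf⟩ := h
      exact Setoid.trans' _ ih (hf.linkSetoid_le_iff.mp (le_iSup _ f))
  · intro h
    let r : Setoid α := ⟨G.Reachable, fun _ => Relation.ReflTransGen.refl,
      fun h => (Relation.ReflTransGen.stdSymm (r := G.Adj)).symm _ _ h,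
      fun h h' => Relation.ReflTransGen.trans h h'⟩
    have hle : ⨆ f, G.linkSetoid f ≤ r := iSup_le fun f =>
      Graph.linkSetoid_le_iff.mpr fun z w hzw => Relation.ReflTransGen.single ⟨f, hzw⟩
    exact hle h

/-- Connectedness in a graph whose edges are those `f ∈ T` that are edges of `G`. -/
theorem reachable_iff_of_isLink {H : Graph α β} {T : Set β}
    (h : ∀ f x y, H.IsLink f x y ↔ f ∈ T ∧ G.IsLink f x y) (x y : α) :
    H.Reachable x y ↔ (⨆ f ∈ T, G.linkSetoid f) x y := by
  rw [reachable_iff]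
  have (f : β) : H.linkSetoid f = ⨆ (_ : f ∈ T), G.linkSetoid f := by
    by_cases hf : f ∈ T
    · rw [iSup_pos hf, linkSetoid, linkSetoid]
      congr 1
      ext x y
      simp [h, hf]
    · rw [iSup_neg hf]
      exact le_bot_iff.mp (linkSetoid_le_iff.mpr fun x y hxy => absurd ((h f x y).mp hxy).1 hf)
  rw [show H.linkSetoid = _ from funext this]

theorem isBridge_iff (he : e ∈ E(G)) :
    G.IsBridge e ↔ ¬ G.linkSetoid e ≤ ⨆ f ∈ E(G) \ {e}, G.linkSetoid f := by
  have h (x y : α) : (G.deleteEdges {e}).Reachable x y ↔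
      (⨆ f ∈ E(G) \ {e}, G.linkSetoid f) x y := by
    refine reachable_iff_of_isLink (fun f x y => ?_) x y
    simp only [deleteEdges_isLink, Set.mem_sdiff]
    exact ⟨fun h => ⟨⟨h.1.edge_mem, h.2⟩, h.1⟩, fun h => ⟨h.2, h.1.2⟩⟩
  simp only [IsBridge, h]
  constructor
  · rintro ⟨x, y, hxy, h'⟩
    rwa [hxy.linkSetoid_le_iff]
  · intro h'
    obtain ⟨x, y, hxy⟩ := exists_isLink_of_mem_edgeSet he
    exact ⟨x, y, hxy, by rwa [hxy.linkSetoid_le_iff] at h'⟩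

theorem isLoop_iff (he : e ∈ E(G)) : G.IsLoop e ↔ G.linkSetoid e = ⊥ := by
  obtain ⟨x, y, hxy⟩ := exists_isLink_of_mem_edgeSet he
  rw [← le_bot_iff, hxy.linkSetoid_le_iff]
  constructor
  · rintro ⟨z, hz⟩
    have hz : G.IsLink e z z := hz
    obtain ⟨rfl, rfl⟩ | ⟨rfl, rfl⟩ := hxy.eq_and_eq_or_eq_and_eq hz <;> rfl
  · intro h
    have h : x = y := h
    subst h
    exact ⟨x, hxy⟩

/-- Spanning forests are the bases of the family of equivalence relations of the edges. -/
theorem isSpanningForest_iff (G : Graph α β) (T : Set β) :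
    G.IsSpanningForest T ↔ IsBasis G.linkSetoid E(G) T := by
  have hG (x y : α) : G.Reachable x y ↔ (⨆ f ∈ E(G), G.linkSetoid f) x y :=
    reachable_iff_of_isLink (fun f x y => ⟨fun h => ⟨h.edge_mem, h⟩, fun h => h.2⟩) x y
  have hT (x y : α) : (G.restrict T).Reachable x y ↔ (⨆ f ∈ T, G.linkSetoid f) x y :=
    reachable_iff_of_isLink (fun f x y => by simp) x y
  have hTf (f : β) (x y : α) : ((G.restrict T).deleteEdges {f}).Reachable x y ↔
      (⨆ g ∈ T \ {f}, G.linkSetoid g) x y :=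
    reachable_iff_of_isLink (fun f x y => by
      simp only [deleteEdges_isLink, restrict_isLink, Set.mem_sdiff]; tauto) x y
  have hbr (hT : T ⊆ E(G)) (f : β) (hf : f ∈ T) : (G.restrict T).IsBridge f ↔
      ¬ G.linkSetoid f ≤ ⨆ g ∈ T \ {f}, G.linkSetoid g := by
    simp only [IsBridge, hTf, restrict_isLink]
    constructor
    · rintro ⟨x, y, hxy, h'⟩
      rwa [hxy.2.linkSetoid_le_iff]
    · intro h'
      obtain ⟨x, y, hxy⟩ := exists_isLink_of_mem_edgeSet (hT hf)
      exact ⟨x, y, ⟨hf, hxy⟩, by rwa [hxy.linkSetoid_le_iff] at h'⟩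
  constructor
  · intro h
    refine ⟨h.subset, fun x y hxy => ?_, fun f hf => (hbr h.subset f hf).mp (h.isBridge f hf)⟩
    exact (hT x y).mp (h.reachable x y ((hG x y).mpr hxy))
  · intro h
    refine ⟨h.subset, fun x y hxy => ?_, fun f hf => (hbr h.subset f hf).mpr (h.indep f hf)⟩
    exact (hT x y).mpr (h.le ((hG x y).mp hxy))

theorem isSpanningForest_deleteEdges_iff (G : Graph α β) (e : β) (T : Set β) :
    (G.deleteEdges {e}).IsSpanningForest T ↔ IsBasis G.linkSetoid (E(G) \ {e}) T := by
  rw [isSpanningForest_iff]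
  change IsBasis _ (E(G) \ {e}) T ↔ _
  by_cases hT : T ⊆ E(G) \ {e}
  · rw [isBasis_iff_image (s := G.linkSetoid) (π := id) _ hT, Set.image_id, Set.image_id]
    · exact and_iff_right (Set.injOn_id T)
    · intro f hf
      simp only [linkSetoid, id]
      congr 1
      ext x y
      simp only [deleteEdges_isLink]
      exact and_iff_left hf.2
  · exact ⟨fun h => absurd h.subset hT, fun h => absurd h.subset hT⟩

/-- Connectedness in `G / e`, seen on the vertices of `G`. -/
theorem comap_iSup_linkSetoid_contractEdge (G : Graph α β) (e : β) {T : Set β} (heT : e ∉ T) :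
    Setoid.comap (Quot.mk (G.IsLink e)) (⨆ f ∈ T, (G.contractEdge e).linkSetoid f) =
      G.linkSetoid e ⊔ ⨆ f ∈ T, G.linkSetoid f := by
  apply le_antisymm
  · set r := G.linkSetoid e ⊔ ⨆ f ∈ T, G.linkSetoid f with hr
    let c : Quot (G.IsLink e) → Quotient r := Quot.lift (Quotient.mk r) fun x y hxy =>
      Quotient.sound (hxy.linkSetoid_le_iff.mp le_sup_left)
    have hle : ⨆ f ∈ T, (G.contractEdge e).linkSetoid f ≤ Setoid.ker c := by
      refine iSup₂_le fun f hf => linkSetoid_le_iff.mpr ?_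
      rintro _ _ ⟨x, y, hxy, rfl, rfl⟩
      have hfr : G.linkSetoid f ≤ r := le_sup_of_le_right (le_iSup₂_of_le f hf le_rfl)
      exact Quotient.sound (IsLink.linkSetoid_le_iff hxy.1 |>.mp hfr)
    intro x y hxy
    exact Quotient.exact (hle hxy)
  · refine sup_le (linkSetoid_le_iff.mpr fun x y hxy => ?_) (iSup₂_le fun f hf =>
      linkSetoid_le_iff.mpr fun x y hxy => ?_)
    · rw [Setoid.comap_rel, Quot.sound hxy]
    · have h : (G.contractEdge e).IsLink f (Quot.mk _ x) (Quot.mk _ y) :=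
        ⟨x, y, ⟨hxy, fun h => heT (Set.mem_singleton_iff.mp h ▸ hf)⟩, rfl, rfl⟩
      rw [Setoid.comap_rel]
      exact h.linkSetoid_le_iff.mp (le_iSup₂_of_le f hf le_rfl)

/-- Spanning forests of `G / e` are the spanning forests of `G` through `e`, without `e`. -/
theorem isSpanningForest_contractEdge_iff (he : e ∈ E(G)) (hl : ¬ G.IsLoop e) [Finite E(G)]
    {T : Set β} (hT : T ⊆ E(G) \ {e}) :
    (G.contractEdge e).IsSpanningForest T ↔ IsBasis G.linkSetoid E(G) (insert e T) := by
  rw [isLoop_iff he] at hl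
  rw [isBasis_insert_iff_of_ne_bot G.exchange_linkSetoid he hl hT
    ((Set.toFinite E(G)).subset (hT.trans Set.sdiff_subset)), isSpanningForest_iff]
  have heT : e ∉ T := fun h => (hT h).2 rfl
  have hcomap {r₁ r₂ : Setoid (Quot (G.IsLink e))} : r₁ ≤ r₂ ↔
      Setoid.comap (Quot.mk (G.IsLink e)) r₁ ≤ Setoid.comap (Quot.mk (G.IsLink e)) r₂ := by
    refine ⟨fun h x y hxy => h hxy, fun h x y => ?_⟩
    induction x using Quot.ind
    induction y using Quot.ind
    exact fun hxy => h hxy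
  have h1 : (⨆ f ∈ E(G.contractEdge e), (G.contractEdge e).linkSetoid f ≤
      ⨆ f ∈ T, (G.contractEdge e).linkSetoid f) ↔
      G.linkSetoid e ⊔ ⨆ f ∈ E(G) \ {e}, G.linkSetoid f ≤
        G.linkSetoid e ⊔ ⨆ f ∈ T, G.linkSetoid f := by
    rw [hcomap, comap_iSup_linkSetoid_contractEdge G e heT]
    change Setoid.comap _ (⨆ f ∈ E(G) \ {e}, _) ≤ _ ↔ _
    rw [comap_iSup_linkSetoid_contractEdge G e (fun h => h.2 rfl)]
  have h2 (f : β) (hf : f ∈ T) : (G.contractEdge e).linkSetoid f ≤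
      ⨆ g ∈ T \ {f}, (G.contractEdge e).linkSetoid g ↔
      G.linkSetoid f ≤ G.linkSetoid e ⊔ ⨆ g ∈ T \ {f}, G.linkSetoid g := by
    have hef : e ∉ ({f} : Set β) := fun h => heT (Set.mem_singleton_iff.mp h ▸ hf)
    have := comap_iSup_linkSetoid_contractEdge G e hef
    rw [iSup_singleton, iSup_singleton] at this
    rw [hcomap, this, comap_iSup_linkSetoid_contractEdge G e (fun h => heT h.1)]
    exact ⟨fun h => le_sup_right.trans h, fun h => sup_le le_sup_left h⟩
  constructor
  · exact fun h => ⟨h1.mp h.le, fun f hf hle => h.indep f hf ((h2 f hf).mpr hle)⟩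
  · exact fun h => ⟨hT, h1.mpr h.1, fun f hf hle => h.2 f hf ((h2 f hf).mp hle)⟩

theorem parallelEdge_linkSetoid (G : Graph α β) (e : β) (m : ℕ) {z : β ⊕ Fin m}
    (hz : z ∈ E(G.parallelEdge e m)) :
    (G.parallelEdge e m).linkSetoid z = G.linkSetoid (Sum.elim id (fun _ => e) z) := by
  simp only [linkSetoid]
  congr 1
  ext x y
  obtain ⟨u, v, huv⟩ := exists_isLink_of_mem_edgeSet hz
  rcases z with g | i
  · exact and_iff_right huv.1
  · rfl

theorem inl_mem_parallelEdge {m : ℕ} :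
    (Sum.inl f : β ⊕ Fin m) ∈ E(G.parallelEdge e m) ↔ f ∈ E(G) \ {e} := by
  constructor
  · rintro ⟨x, y, h⟩
    exact ⟨h.2.edge_mem, h.1⟩
  · rintro ⟨h, hne⟩
    obtain ⟨x, y, hxy⟩ := exists_isLink_of_mem_edgeSet h
    exact ⟨x, y, hne, hxy⟩

theorem inr_mem_parallelEdge (he : e ∈ E(G)) {m : ℕ} (i : Fin m) :
    (Sum.inr i : β ⊕ Fin m) ∈ E(G.parallelEdge e m) := by
  obtain ⟨x, y, hxy⟩ := exists_isLink_of_mem_edgeSet he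
  exact ⟨x, y, hxy⟩

/-- A spanning forest of the graph with `m > 0` parallel copies of `e` is a spanning forest of
`G` avoiding `e`, or one through `e` with `e` replaced by one of its copies. -/
theorem isSpanningForest_parallelEdge_iff (he : e ∈ E(G)) {m : ℕ} (hm : m ≠ 0) {T : Set β}
    (hT : T ⊆ E(G) \ {e}) (S : Finset (Fin m)) :
    (G.parallelEdge e m).IsSpanningForest (Sum.inr '' (S : Set (Fin m)) ∪ Sum.inl '' T) ↔
      (S = ∅ ∧ IsBasis G.linkSetoid E(G) T) ∨
      ((∃ i, S = {i}) ∧ IsBasis G.linkSetoid E(G) (insert e T)) := by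
  have heT : e ∉ T := fun h => (hT h).2 rfl
  have hsub : Sum.inr '' (S : Set (Fin m)) ∪ Sum.inl '' T ⊆ E(G.parallelEdge e m) := by
    rintro _ (⟨i, -, rfl⟩ | ⟨f, hf, rfl⟩)
    · exact inr_mem_parallelEdge he i
    · exact inl_mem_parallelEdge.mpr (hT hf)
  rw [isSpanningForest_iff, isBasis_iff_image (s := G.linkSetoid)
    (fun z hz => parallelEdge_linkSetoid G e m hz) hsub]
  have hE : Sum.elim id (fun _ => e) '' E(G.parallelEdge e m) = E(G) := by
    ext f
    constructor
    · rintro ⟨g | i, hz, rfl⟩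
      · exact (inl_mem_parallelEdge.mp hz).1
      · exact he
    · intro hf
      by_cases hfe : f = e
      · exact ⟨Sum.inr ⟨0, Nat.pos_of_ne_zero hm⟩, inr_mem_parallelEdge he _, hfe.symm⟩
      · exact ⟨Sum.inl f, inl_mem_parallelEdge.mpr ⟨hf, hfe⟩, rfl⟩
  have himT : Sum.elim id (fun _ : Fin m => e) '' (Sum.inl '' T) = T := by
    rw [Set.image_image]
    exact Set.image_id T
  rw [hE, Set.image_union, himT]
  obtain rfl | ⟨i, hi⟩ := S.eq_empty_or_nonempty
  · have : Set.InjOn (Sum.elim id (fun _ : Fin m => e)) (Sum.inl '' T) := by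
      rintro _ ⟨f, hf, rfl⟩ _ ⟨g, hg, rfl⟩ (h : f = g)
      rw [h]
    simp [this]
  · have himS : Sum.elim id (fun _ : Fin m => e) '' (Sum.inr '' (S : Set (Fin m))) = {e} := by
      rw [Set.image_image]
      exact (Set.Nonempty.image_const ⟨i, hi⟩ e)
    have hinj : Set.InjOn (Sum.elim id (fun _ : Fin m => e))
        (Sum.inr '' (S : Set (Fin m)) ∪ Sum.inl '' T) ↔ ∃ i, S = {i} := by
      constructor
      · intro h
        refine ⟨i, Finset.eq_singleton_iff_unique_mem.mpr ⟨hi, fun j hj => ?_⟩⟩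
        exact Sum.inr_injective (h (Or.inl ⟨j, hj, rfl⟩) (Or.inl ⟨i, hi, rfl⟩) rfl)
      · rintro ⟨i, rfl⟩ _ (⟨j, hj, rfl⟩ | ⟨f, hf, rfl⟩) _ (⟨l, hl, rfl⟩ | ⟨g, hg, rfl⟩) h
        · rw [Finset.mem_coe, Finset.mem_singleton] at hj hl
          rw [hj, hl]
        · exact absurd (show e = g from h) fun h => heT (h ▸ hg)
        · exact absurd (show f = e from h) fun h => heT (h ▸ hf)
        · rw [show f = g from h]
    rw [himS, hinj, Set.singleton_union]
    simp [Finset.ne_empty_of_mem hi]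

end Graph

/-! ### The Kirchhoff polynomial of a graph with parallel edges -/

namespace Variety

open scoped Classical in
/-- The sum over the finite sets `S` satisfying `p` of the product of the variables outside
`S`. -/
noncomputable def complSum (k : Type u) [CommRing k] (σ : Type*) [Fintype σ]
    (p : Finset σ → Prop) : MvPolynomial σ k :=
  ∑ S with p S, ∏ i ∈ Sᶜ, MvPolynomial.X i

section ComplSum

variable {k : Type u} [CommRing k] {σ τ : Type*} [Fintype σ] [Fintype τ]

open scoped Classical in
theorem rename_complSum (ε : σ ≃ τ) (p : Finset τ → Prop) :
    MvPolynomial.rename ε (complSum k σ fun S => p (S.map ε.toEmbedding)) = complSum k τ p := by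
  simp only [complSum, map_sum, map_prod, MvPolynomial.rename_X]
  refine Finset.sum_equiv (Equiv.finsetCongr ε) (fun S => by simp) fun S _ => ?_
  refine Finset.prod_equiv ε (fun i => ?_) fun i _ => rfl
  simp

/-- If the members of a family of subsets of `ι ⊕ σ` meet `ι` in no element, or in an arbitrary
single element, then their polynomial is a `parallelPoly`. -/
theorem sumAlgEquiv_complSum {ι : Type} [Fintype ι] [DecidableEq ι] {σ : Type u} [Fintype σ]
    {p : Finset (ι ⊕ σ) → Prop} {p₀ p₁ : Finset σ → Prop}
    (h : ∀ (S : Finset ι) (T : Finset σ), p (S.disjSum T) ↔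
      (S = ∅ ∧ p₀ T) ∨ ((∃ i, S = {i}) ∧ p₁ T)) :
    MvPolynomial.sumAlgEquiv k ι σ (complSum k (ι ⊕ σ) p) =
      parallelPoly ι (complSum k σ p₀) (complSum k σ p₁) := by
  classical
  have hcompl (S : Finset ι) (T : Finset σ) : (S.disjSum T)ᶜ = (Sᶜ).disjSum (Tᶜ) := by
    ext (i | i) <;> simp
  have hprod (S : Finset ι) (T : Finset σ) : MvPolynomial.sumAlgEquiv k ι σ
      (∏ i ∈ (S.disjSum T)ᶜ, MvPolynomial.X i) =
      (∏ i ∈ Sᶜ, MvPolynomial.X i) * MvPolynomial.C (∏ i ∈ Tᶜ, MvPolynomial.X i) := by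
    rw [hcompl, Finset.prod_disjSum, map_mul, map_prod, map_prod, map_prod]
    simp only [MvPolynomial.sumAlgEquiv_X_inl, MvPolynomial.sumAlgEquiv_X_inr]
  have hsum : MvPolynomial.sumAlgEquiv k ι σ (complSum k (ι ⊕ σ) p) =
      ∑ S : Finset ι, ∑ T : Finset σ, if p (S.disjSum T) then
        (∏ i ∈ Sᶜ, MvPolynomial.X i) * MvPolynomial.C (∏ i ∈ Tᶜ, MvPolynomial.X i) else 0 := by
    rw [complSum, Finset.sum_filter, map_sum, ← Fintype.sum_prod_type']
    refine Fintype.sum_equiv Finset.sumEquiv.toEquiv _ _ fun U => ?_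
    obtain ⟨S, T, rfl⟩ : ∃ S T, Finset.disjSum S T = U := ⟨_, _, Finset.toLeft_disjSum_toRight⟩
    simp only [← hprod]
    have : Finset.sumEquiv (S.disjSum T) = (S, T) := by
      simpa using Finset.sumEquiv.apply_symm_apply (S, T)
    simp only [RelIso.coe_fn_toEquiv, this]
    by_cases hp : p (S.disjSum T)
    · rw [if_pos hp, if_pos hp]
      congr!
    · rw [if_neg hp, if_neg hp, map_zero]
  have hsplit (S : Finset ι) (T : Finset σ) (x : MvPolynomial ι (MvPolynomial σ k)) :
      (if p (S.disjSum T) then x else 0) = (if S = ∅ then (if p₀ T then x else 0) else 0) +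
        ∑ i, if S = {i} then (if p₁ T then x else 0) else 0 := by
    simp only [h]
    obtain rfl | hS := S.eq_empty_or_nonempty
    · have h1 (i : ι) : (∅ : Finset ι) ≠ {i} := (Finset.singleton_ne_empty i).symm
      simp [h1]
    · by_cases hi : ∃ i, S = {i}
      · obtain ⟨i, rfl⟩ := hi
        simp
      · push Not at hi
        simp [hS.ne_empty, hi]
  rw [hsum]
  simp only [hsplit, Finset.sum_add_distrib]
  rw [parallelPoly]
  congr 1
  · simp only [complSum, Finset.sum_filter, map_sum, Finset.mul_sum, apply_ite MvPolynomial.C,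
      MvPolynomial.C_0]
    rw [Finset.sum_eq_single ∅ (fun S _ hS => by simp [hS]) (by simp)]
    simp
  · simp only [complSum, Finset.sum_filter, map_sum, Finset.mul_sum, apply_ite MvPolynomial.C,
      MvPolynomial.C_0, Finset.sum_mul]
    rw [Finset.sum_comm]
    refine Finset.sum_congr rfl fun T _ => ?_
    rw [Finset.sum_comm]
    refine Finset.sum_congr rfl fun i _ => ?_
    rw [Finset.sum_eq_single {i} (fun S _ hS => by simp [hS]) (by simp)]
    simp [Finset.compl_singleton]

/-- The Kirchhoff polynomial as a sum over finite sets of edges of `G`. -/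
theorem kirchhoff_eq_complSum {α : Type v} {β : Type u} (G : Graph α β) [Fintype E(G)] :
    G.kirchhoff k = complSum k E(G) fun S =>
      G.IsSpanningForest (Subtype.val '' (S : Set E(G))) := by
  classical
  have hF (T : Set β) : ∏ᶠ (e : E(G)) (_ : (e : β) ∉ T), (MvPolynomial.X e : MvPolynomial E(G) k) =
      ∏ e ∈ (Finset.univ.filter fun e : E(G) => (e : β) ∉ T : Finset E(G)),
        (MvPolynomial.X e : MvPolynomial E(G) k) := by
    rw [← finprod_mem_coe_finset]
    simp
  have himage : {T : Set β | G.IsSpanningForest T} =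
      (fun S : Finset E(G) => Subtype.val '' (S : Set E(G))) ''
        ((Finset.univ.filter fun S : Finset E(G) =>
          G.IsSpanningForest (Subtype.val '' (S : Set E(G))) : Finset (Finset E(G))) :
            Set (Finset E(G))) := by
    ext T
    constructor
    · intro hT
      refine ⟨Finset.univ.filter fun e : E(G) => (e : β) ∈ T, ?_, ?_⟩
      all_goals
        have : Subtype.val '' ((Finset.univ.filter fun e : E(G) => (e : β) ∈ T :
            Finset E(G)) : Set E(G)) = T := by
          ext e
          simpa using fun h => hT.subset h
      · rw [Finset.mem_coe, Finset.mem_filter, this]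
        exact ⟨Finset.mem_univ _, hT⟩
      · exact this
    · rintro ⟨S, hS, rfl⟩
      simpa using hS
  have hinj : Function.Injective (fun S : Finset E(G) => Subtype.val '' (S : Set E(G))) :=
    (Set.image_injective.mpr Subtype.val_injective).comp Finset.coe_injective
  simp only [Graph.kirchhoff, hF]
  change ∑ᶠ T ∈ {T : Set β | G.IsSpanningForest T}, _ = _
  rw [himage, finsum_mem_image hinj.injOn, finsum_mem_coe_finset, complSum]
  refine Finset.sum_congr rfl fun S _ => Finset.prod_congr ?_ fun _ _ => rfl
  ext e
  simp

end ComplSum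

/-! ### Classes of graph hypersurface complements -/

section GraphClass

variable {k : Type u} [Field k] {α : Type v} {β : Type u}

theorem graphClass_eq_complClass (G : Graph α β) [Finite E(G)] :
    graphClass k G = complClass k (MvPolynomial E(G) k) (G.kirchhoff k) :=
  cls_hypersurfaceComplement _

/-- Graphs whose edges correspond to each other, with the same ends, have the same class. -/
theorem graphClass_eq_of_bijOn {β' : Type u} {G : Graph α β} {G' : Graph α β'}
    [Finite E(G)] [Finite E(G')] (π : β' → β) (hπ : Set.BijOn π E(G') E(G))
    (h : ∀ f ∈ E(G'), ∀ x y, G'.IsLink f x y ↔ G.IsLink (π f) x y) :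
    graphClass k G' = graphClass k G := by
  have := Fintype.ofFinite E(G)
  have := Fintype.ofFinite E(G')
  let ε : E(G') ≃ E(G) := hπ.equiv π
  rw [graphClass_eq_complClass, graphClass_eq_complClass, kirchhoff_eq_complSum,
    kirchhoff_eq_complSum, ← rename_complSum ε, complClass_congr (MvPolynomial.renameEquiv k ε)]
  simp only [MvPolynomial.renameEquiv_apply]
  congr 3
  ext S
  have hsub : Subtype.val '' (S : Set E(G')) ⊆ E(G') := by
    rintro _ ⟨f, -, rfl⟩
    exact f.2
  have himage : Subtype.val '' ((S.map ε.toEmbedding : Finset E(G)) : Set E(G)) =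
      π '' (Subtype.val '' (S : Set E(G'))) := by
    rw [Finset.coe_map, Set.image_image, Set.image_image]
    rfl
  rw [Graph.isSpanningForest_iff, Graph.isSpanningForest_iff, himage,
    LatticeBasis.isBasis_iff_image (s := G.linkSetoid) (π := π) _ hsub, hπ.image_eq]
  · exact and_iff_right (hπ.injOn.mono hsub)
  · intro f hf
    simp only [Graph.linkSetoid]
    congr 1
    ext x y
    exact h f hf x y

theorem graphClass_of_edgeSet_eq_empty {G : Graph α β} [Finite E(G)] (h : E(G) = ∅) :
    graphClass k G = 1 := by
  have hE : IsEmpty E(G) := Set.isEmpty_coe_sort.mpr h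
  have := Fintype.ofFinite E(G)
  have hS (S : Finset E(G)) : G.IsSpanningForest (Subtype.val '' (S : Set E(G))) := by
    rw [Finset.eq_empty_of_isEmpty S, Graph.isSpanningForest_iff]
    exact ⟨by simp, by simp [h], by simp⟩
  have hk : G.kirchhoff k = 1 := by
    rw [kirchhoff_eq_complSum, complSum, Finset.sum_filter, Fintype.sum_unique, if_pos (hS _)]
    exact Finset.prod_of_isEmpty _
  rw [graphClass_eq_complClass, hk, complClass_one,
    cls_affine_congr (MvPolynomial.isEmptyAlgEquiv k E(G)), cls_affine_self]

theorem graphClass_parallelEdge_zero (G : Graph α β) [Finite E(G)] (e : β) :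
    graphClass k (G.parallelEdge e 0) = graphClass k (G.deleteEdges {e}) := by
  refine graphClass_eq_of_bijOn (Sum.elim id Fin.elim0) ⟨?_, ?_, ?_⟩ ?_
  · rintro (f | i) hf
    · exact Graph.inl_mem_parallelEdge.mp hf
    · exact i.elim0
  · rintro (f | i) - (g | j) - h
    · rw [show f = g from h]
    all_goals exact Fin.elim0 ‹_›
  · exact fun f hf => ⟨Sum.inl f, Graph.inl_mem_parallelEdge.mpr hf, rfl⟩
  · rintro (f | i) hf x y
    · exact and_comm
    · exact i.elim0

theorem graphClass_parallelEdge_one (G : Graph α β) [Finite E(G)] {e : β} (he : e ∈ E(G)) :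
    graphClass k (G.parallelEdge e 1) = graphClass k G := by
  refine graphClass_eq_of_bijOn (Sum.elim id fun _ => e) ⟨?_, ?_, ?_⟩ ?_
  · rintro (f | i) hf
    · exact (Graph.inl_mem_parallelEdge.mp hf).1
    · exact he
  · rintro (f | i) hf (g | j) hg h
    · rw [show f = g from h]
    · exact absurd (show f = e from h) (Graph.inl_mem_parallelEdge.mp hf).2
    · exact absurd (show e = g from h).symm (Graph.inl_mem_parallelEdge.mp hg).2
    · rw [Subsingleton.elim i j]
  · intro f hf
    by_cases hfe : f = e
    · exact ⟨Sum.inr 0, Graph.inr_mem_parallelEdge he _, hfe.symm⟩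
    · exact ⟨Sum.inl f, Graph.inl_mem_parallelEdge.mpr ⟨hf, hfe⟩, rfl⟩
  · rintro (f | i) hf x y
    · exact and_iff_right (Graph.inl_mem_parallelEdge.mp hf).2
    · exact Iff.rfl

/-- The edges of the graph with `m` parallel copies of `e`: the copies, and the edges of the
deletion. -/
noncomputable def parallelEdgeEquiv (G : Graph α β) {e : β} (he : e ∈ E(G)) (m : ℕ) :
    Fin m ⊕ E(G.deleteEdges {e}) ≃ E(G.parallelEdge e m) :=
  Equiv.ofBijective (Sum.elim (fun i => ⟨Sum.inr i, Graph.inr_mem_parallelEdge he i⟩)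
    (fun f => ⟨Sum.inl f, Graph.inl_mem_parallelEdge.mpr f.2⟩)) <| by
    constructor
    · rintro (i | f) (j | g) h
      · exact congrArg Sum.inl (Sum.inr_injective (congrArg Subtype.val h))
      · exact absurd (congrArg Subtype.val h) Sum.inr_ne_inl
      · exact absurd (congrArg Subtype.val h) Sum.inl_ne_inr
      · exact congrArg Sum.inr (Subtype.ext (Sum.inl_injective (congrArg Subtype.val h)))
    · rintro ⟨f | i, h⟩
      · exact ⟨Sum.inr ⟨f, Graph.inl_mem_parallelEdge.mp h⟩, rfl⟩
      · exact ⟨Sum.inl i, rfl⟩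

open LatticeBasis in
/-- The class of the graph with `m > 0` parallel copies of `e`, in terms of the spanning forests
avoiding `e` and those through `e`. -/
theorem graphClass_parallelEdge (G : Graph α β) {e : β} (he : e ∈ E(G)) [Finite E(G)]
    [Fintype E(G.deleteEdges {e})] {m : ℕ} (hm : m ≠ 0) :
    graphClass k (G.parallelEdge e m) =
      complClass k (MvPolynomial (Fin m) (MvPolynomial E(G.deleteEdges {e}) k))
        (parallelPoly (Fin m)
          (complSum k E(G.deleteEdges {e}) fun T =>
            IsBasis G.linkSetoid E(G) (Subtype.val '' (T : Set E(G.deleteEdges {e}))))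
          (complSum k E(G.deleteEdges {e}) fun T =>
            IsBasis G.linkSetoid E(G)
              (insert e (Subtype.val '' (T : Set E(G.deleteEdges {e})))))) := by
  have := Fintype.ofFinite E(G.parallelEdge e m)
  set ε := parallelEdgeEquiv G he m
  rw [graphClass_eq_complClass, kirchhoff_eq_complSum, ← rename_complSum ε,
    ← MvPolynomial.renameEquiv_apply, ← complClass_congr (MvPolynomial.renameEquiv k ε),
    complClass_congr (MvPolynomial.sumAlgEquiv k (Fin m) E(G.deleteEdges {e}))]
  congr 1
  refine sumAlgEquiv_complSum fun S T => ?_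
  have hT : Subtype.val '' (T : Set E(G.deleteEdges {e})) ⊆ E(G) \ {e} := by
    rintro _ ⟨f, -, rfl⟩
    exact f.2
  rw [← Graph.isSpanningForest_parallelEdge_iff he hm hT S]
  have himage : Subtype.val '' (((S.disjSum T).map ε.toEmbedding :
      Finset E(G.parallelEdge e m)) : Set E(G.parallelEdge e m)) =
      Sum.inr '' (S : Set (Fin m)) ∪
        Sum.inl '' (Subtype.val '' (T : Set E(G.deleteEdges {e}))) := by
    ext z
    simp only [Finset.coe_map, Set.mem_image, Finset.mem_coe, Set.mem_union, Equiv.coe_toEmbedding]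
    constructor
    · rintro ⟨_, ⟨i | f, hi, rfl⟩, rfl⟩
      · exact Or.inl ⟨i, Finset.inl_mem_disjSum.mp hi, rfl⟩
      · exact Or.inr ⟨f, ⟨f, Finset.inr_mem_disjSum.mp hi, rfl⟩, rfl⟩
    · rintro (⟨i, hi, rfl⟩ | ⟨_, ⟨f, hf, rfl⟩, rfl⟩)
      · exact ⟨_, ⟨Sum.inl i, Finset.inl_mem_disjSum.mpr hi, rfl⟩, rfl⟩
      · exact ⟨_, ⟨Sum.inr f, Finset.inr_mem_disjSum.mpr hf, rfl⟩, rfl⟩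
  rw [himage]

end GraphClass

end Variety

/-! ### Exponential generating functions of integral polynomials -/

namespace ExpGen

open Polynomial in
/-- The exponential generating function of a sequence of polynomials in `T` with integer
coefficients. -/
noncomputable def polyEgf (P : ℕ → ℤ[X]) : PowerSeries ℚ[X] :=
  PowerSeries.mk fun m => C (m ! : ℚ)⁻¹ * (P m).map (Int.castRingHom ℚ)

theorem polyEgf_add (P Q : ℕ → Polynomial ℤ) : polyEgf P + polyEgf Q = polyEgf (P + Q) := by
  ext1 m
  simp [polyEgf, mul_add]

theorem polyEgf_sub (P Q : ℕ → Polynomial ℤ) : polyEgf P - polyEgf Q = polyEgf (P - Q) := by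
  ext1 m
  simp [polyEgf, mul_sub]

theorem C_X_mul_polyEgf (P : ℕ → Polynomial ℤ) :
    PowerSeries.C Polynomial.X * polyEgf P = polyEgf fun m => Polynomial.X * P m := by
  ext1 m
  simp only [polyEgf, PowerSeries.coeff_C_mul, PowerSeries.coeff_mk, Polynomial.map_mul,
    Polynomial.map_X]
  ring

theorem expS_X_eq_polyEgf : expS Polynomial.X = polyEgf fun m => Polynomial.X ^ m := by
  ext1 m
  rw [expS, polyEgf, PowerSeries.coeff_rescale, PowerSeries.coeff_exp, PowerSeries.coeff_mk,
    Polynomial.map_pow, Polynomial.map_X, one_div, mul_comm, Polynomial.algebraMap_eq]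

theorem expS_neg_one_eq_polyEgf : expS (-1) = polyEgf fun m => (-1) ^ m := by
  ext1 m
  rw [expS, polyEgf, PowerSeries.coeff_rescale, PowerSeries.coeff_exp, PowerSeries.coeff_mk,
    Polynomial.map_pow, Polynomial.map_neg, Polynomial.map_one, one_div, mul_comm,
    Polynomial.algebraMap_eq]

theorem one_eq_polyEgf : 1 = polyEgf fun m => if m = 0 then 1 else 0 := by
  ext1 m
  rw [polyEgf, PowerSeries.coeff_mk, PowerSeries.coeff_one]
  split_ifs with h
  · simp [h]
  · simp

theorem X_mul_expS_X_eq_polyEgf :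
    PowerSeries.X * expS Polynomial.X =
      polyEgf fun m => (m : Polynomial ℤ) * Polynomial.X ^ (m - 1) := by
  ext1 m
  rw [expS_X_eq_polyEgf]
  cases m with
  | zero => simp [polyEgf]
  | succ m =>
    rw [PowerSeries.coeff_succ_X_mul, polyEgf, polyEgf, PowerSeries.coeff_mk, PowerSeries.coeff_mk]
    have h : (m ! : ℚ)⁻¹ = ((m + 1) ! : ℚ)⁻¹ * (m + 1 : ℕ) := by
      rw [Nat.factorial_succ]
      push_cast
      field_simp
    rw [h, Polynomial.C_mul, Nat.add_sub_cancel, Polynomial.map_mul, Polynomial.map_natCast,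
      Polynomial.C_eq_natCast, mul_assoc]

theorem C_X_add_C_one_mul_cancel {f g : PowerSeries (Polynomial ℚ)}
    (h : PowerSeries.C (Polynomial.X + Polynomial.C 1) * f =
      PowerSeries.C (Polynomial.X + Polynomial.C 1) * g) : f = g := by
  ext1 m
  refine X_add_C_one_mul_cancel ?_
  rw [← PowerSeries.coeff_C_mul, h, PowerSeries.coeff_C_mul]

theorem C_X_add_C_one_mul_polyEgf (P : ℕ → Polynomial ℤ) :
    PowerSeries.C (Polynomial.X + Polynomial.C 1) * polyEgf P =
      polyEgf fun m => (Polynomial.X + Polynomial.C 1) * P m := by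
  ext1 m
  simp only [polyEgf, PowerSeries.coeff_C_mul, PowerSeries.coeff_mk, Polynomial.map_mul,
    Polynomial.map_X, Polynomial.map_add, map_one, Polynomial.map_one]
  ring

theorem quotF_eq_polyEgf : quotF = polyEgf polyF := by
  refine C_X_add_C_one_mul_cancel ?_
  rw [quotF_spec, C_X_add_C_one_mul_polyEgf, expS_X_eq_polyEgf, expS_neg_one_eq_polyEgf,
    polyEgf_sub]
  exact congrArg polyEgf (funext fun m => (polyF_spec m).symm)

theorem quotG_eq_polyEgf : quotG = polyEgf polyG := by
  refine C_X_add_C_one_mul_cancel ?_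
  rw [quotG_spec, C_X_add_C_one_mul_polyEgf, expS_X_eq_polyEgf, expS_neg_one_eq_polyEgf,
    C_X_mul_polyEgf, polyEgf_add]
  refine congrArg polyEgf (funext fun m => ?_)
  rw [polyG_spec, Pi.add_apply, mul_comm ((-1) ^ m)]

variable {R : Type v} [CommRing R]

theorem egf_add (a b : ℕ → R) : egf a + egf b = egf fun m => a m + b m := by
  ext1 m
  simp [egf, TensorProduct.tmul_add]

theorem spec_polyEgf_mul_const (t a : R) (P : ℕ → Polynomial ℤ) :
    spec t (polyEgf P) * const a = egf fun m => Polynomial.aeval t (P m) * a := by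
  ext1 m
  have h : Polynomial.aeval ((1 : ℚ) ⊗ₜ[ℤ] t) ((P m).map (Int.castRingHom ℚ)) =
      (1 : ℚ) ⊗ₜ[ℤ] Polynomial.aeval t (P m) := by
    have h1 := Polynomial.aeval_map_algebraMap ℚ ((1 : ℚ) ⊗ₜ[ℤ] t) (P m)
    rw [algebraMap_int_eq] at h1
    rw [h1]
    exact Polynomial.aeval_algHom_apply
      (Algebra.TensorProduct.includeRight : R →ₐ[ℤ] TensorProduct ℤ ℚ R) t (P m)
  rw [const, PowerSeries.coeff_mul_C, spec, PowerSeries.coeff_map, polyEgf, PowerSeries.coeff_mk,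
    egf, PowerSeries.coeff_mk, AlgHom.toRingHom_eq_coe, RingHom.coe_coe, map_mul, h,
    Polynomial.aeval_C, Algebra.TensorProduct.algebraMap_apply,
    Algebra.TensorProduct.tmul_mul_tmul, Algebra.TensorProduct.tmul_mul_tmul]
  simp

end ExpGen

/-! ### Multiplying a loop, a bridge, or another edge -/

namespace Variety

open ExpGen LatticeBasis

variable {k : Type u} [Field k] {α : Type v} {β : Type u}

theorem graphClass_deleteEdges (G : Graph α β) (e : β) [Finite E(G)]
    [Fintype E(G.deleteEdges {e})] : graphClass k (G.deleteEdges {e}) =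
      complClass k (MvPolynomial E(G.deleteEdges {e}) k) (complSum k E(G.deleteEdges {e}) fun T =>
        IsBasis G.linkSetoid (E(G) \ {e}) (Subtype.val '' (T : Set E(G.deleteEdges {e})))) := by
  rw [graphClass_eq_complClass, kirchhoff_eq_complSum]
  simp only [Graph.isSpanningForest_deleteEdges_iff]

theorem image_val_subset (G : Graph α β) (e : β) (T : Finset E(G.deleteEdges {e})) :
    Subtype.val '' (T : Set E(G.deleteEdges {e})) ⊆ E(G) \ {e} := by
  rintro _ ⟨f, -, rfl⟩
  exact f.2

theorem graphClass_contractEdge (G : Graph α β) {e : β} (he : e ∈ E(G)) (hl : ¬ G.IsLoop e)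
    [Finite E(G)] [Fintype E(G.deleteEdges {e})] : graphClass k (G.contractEdge e) =
      complClass k (MvPolynomial E(G.deleteEdges {e}) k) (complSum k E(G.deleteEdges {e}) fun T =>
        IsBasis G.linkSetoid E(G) (insert e (Subtype.val '' (T : Set E(G.deleteEdges {e}))))) := by
  -- contraction and deletion have the same edge set by definition
  let : Fintype E(G.contractEdge e) := ‹Fintype E(G.deleteEdges {e})›
  rw [graphClass_eq_complClass, kirchhoff_eq_complSum]
  have h : (fun S : Finset E(G.contractEdge e) =>
      (G.contractEdge e).IsSpanningForest (Subtype.val '' (S : Set E(G.contractEdge e)))) =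
      fun S : Finset E(G.deleteEdges {e}) =>
        IsBasis G.linkSetoid E(G) (insert e (Subtype.val '' (S : Set E(G.deleteEdges {e})))) := by
    ext S
    exact Graph.isSpanningForest_contractEdge_iff he hl (image_val_subset G e S)
  rw [h]
  rfl

theorem complSum_false {σ : Type*} [Fintype σ] {p : Finset σ → Prop} (h : ∀ S, ¬ p S) :
    complSum k σ p = 0 := by
  simp [complSum, h]

/-- No spanning forest contains a loop, so that only the term `∏ t_i · a` is left. -/
theorem graphClass_parallelEdge_of_isLoop (G : Graph α β) [Finite E(G)] {e : β} (he : e ∈ E(G))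
    (hl : G.IsLoop e) (m : ℕ) : graphClass k (G.parallelEdge e m) =
      torusClass k ^ m * graphClass k (G.deleteEdges {e}) := by
  have := Fintype.ofFinite E(G.deleteEdges {e})
  rcases eq_or_ne m 0 with rfl | hm
  · rw [graphClass_parallelEdge_zero, pow_zero, one_mul]
  have hbot := (Graph.isLoop_iff he).mp hl
  rw [graphClass_parallelEdge G he hm, complSum_false (p := fun T => IsBasis _ _ (insert e _))
    fun T h => h.notMem_of_eq_bot hbot (Set.mem_insert e _), graphClass_deleteEdges]
  simp only [isBasis_sdiff_iff_of_le he (hbot.trans_le bot_le) (image_val_subset G e _)]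
  rw [← complClass_prod_X_mul_C, parallelPoly, MvPolynomial.C_0, mul_zero, add_zero]

/-- All spanning forests contain a bridge, so that for `m > 0` only the term
`(∑ᵢ ∏_{j ≠ i} t_j) · b` is left. For `m = 0` the bridge is deleted, whence the extra summand. -/
theorem graphClass_parallelEdge_of_isBridge (G : Graph α β) [Finite E(G)] {e : β} (he : e ∈ E(G))
    (hb : G.IsBridge e) (m : ℕ) : graphClass k (G.parallelEdge e m) =
      (torusClass k * Polynomial.aeval (torusClass k) (polyF m) +
        m * torusClass k ^ (m - 1) + (if m = 0 then 1 else 0)) *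
          graphClass k (G.deleteEdges {e}) := by
  have := Fintype.ofFinite E(G.deleteEdges {e})
  rcases eq_or_ne m 0 with rfl | hm
  · rw [graphClass_parallelEdge_zero]
    simp [polyF_zero]
  rw [Graph.isBridge_iff he] at hb
  rw [graphClass_parallelEdge G he hm, complSum_false (p := fun T => IsBasis _ _ (Subtype.val '' _))
    fun T h => (image_val_subset G e T (h.mem_of_not_le he hb)).2 rfl, graphClass_deleteEdges]
  simp only [isBasis_insert_iff_of_not_le G.exchange_linkSetoid he hb (image_val_subset G e _)]
  rw [complClass_parallelPoly, complClass_parallelPoly_succ, complClass_zero, parallelPoly_zero,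
    MvPolynomial.C_0, zero_mul, complClass_zero, if_neg hm]
  ring

/-- Here `a` and `b` are the Kirchhoff polynomials of the deletion and the contraction, and the
case of one variable is the graph `G` itself. -/
theorem graphClass_parallelEdge_of_not_isBridge_of_not_isLoop (G : Graph α β) [Finite E(G)]
    {e : β} (he : e ∈ E(G)) (hb : ¬ G.IsBridge e) (hl : ¬ G.IsLoop e) (m : ℕ) :
    graphClass k (G.parallelEdge e m) =
      Polynomial.aeval (torusClass k) (polyF m) * graphClass k G +
      Polynomial.aeval (torusClass k) (polyG m) * graphClass k (G.deleteEdges {e}) +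
      (m * torusClass k ^ (m - 1) - Polynomial.aeval (torusClass k) (polyF m)) *
        graphClass k (G.contractEdge e) := by
  have := Fintype.ofFinite E(G.deleteEdges {e})
  rcases eq_or_ne m 0 with rfl | hm
  · rw [graphClass_parallelEdge_zero]
    simp [polyF_zero, polyG_zero]
  rw [Graph.isBridge_iff he, not_not] at hb
  rw [← graphClass_parallelEdge_one G he, graphClass_parallelEdge G he hm,
    graphClass_parallelEdge G he one_ne_zero, complClass_parallelPoly m,
    graphClass_deleteEdges, graphClass_contractEdge G he hl]
  simp only [isBasis_sdiff_iff_of_le he hb (image_val_subset G e _)]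

theorem graphClass_banana (x y : α) (F : Set β) [Finite F] (hxy : x ≠ y) :
    graphClass k (Graph.banana x y F) =
      torusClass k * Polynomial.aeval (torusClass k) (polyF F.ncard) +
        F.ncard * torusClass k ^ (F.ncard - 1) + (if F.ncard = 0 then 1 else 0) := by
  obtain rfl | ⟨f, hf⟩ := F.eq_empty_or_nonempty
  · rw [graphClass_of_edgeSet_eq_empty rfl]
    simp [polyF_zero]
  -- the banana graph is obtained from its subgraph with the single edge `f`, a bridge
  have hf' : f ∈ E(Graph.banana x y {f}) := rfl
  have hdel : E((Graph.banana x y {f}).deleteEdges {f}) = ∅ := Set.sdiff_self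
  have hb : (Graph.banana x y {f}).IsBridge f := by
    refine (Graph.isBridge_iff hf').mpr fun hle => hxy ?_
    have hlink : (Graph.banana x y {f}).IsLink f x y := by simp
    have hE : E(Graph.banana x y {f}) \ {f} = ∅ := Set.sdiff_self
    rw [hE, iSup_emptyset, hlink.linkSetoid_le_iff] at hle
    exact hle
  let ε : Fin F.ncard ≃ F := (Finite.equivFin F).symm
  have h := graphClass_parallelEdge_of_isBridge (k := k) _ hf' hb F.ncard
  rw [graphClass_of_edgeSet_eq_empty hdel, mul_one] at h
  rw [← h]
  have hinl (g : β) : (Sum.inl g : β ⊕ Fin F.ncard) ∉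
      E((Graph.banana x y {f}).parallelEdge f F.ncard) := fun hg => by
    obtain ⟨h1, h2⟩ := Graph.inl_mem_parallelEdge.mp hg
    exact h2 h1
  refine (graphClass_eq_of_bijOn (Sum.elim id fun i => (ε i : β)) ⟨?_, ?_, ?_⟩ ?_).symm
  · rintro (g | i) hg
    · exact absurd hg (hinl g)
    · exact (ε i).2
  · rintro (g | i) hg (g' | j) hg' hij
    · exact absurd hg (hinl g)
    · exact absurd hg (hinl g)
    · exact absurd hg' (hinl g')
    · exact congrArg Sum.inr (ε.injective (Subtype.ext hij))
  · intro g hg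
    obtain ⟨i, hi⟩ := ε.surjective ⟨g, hg⟩
    exact ⟨Sum.inr i, Graph.inr_mem_parallelEdge hf' i, congrArg Subtype.val hi⟩
  · rintro (g | i) hg z w
    · exact absurd hg (hinl g)
    · change (Graph.banana x y {f}).IsLink f z w ↔ (Graph.banana x y F).IsLink (ε i) z w
      simp

end Variety

open Variety ExpGen in
theorem theorem5p3 {k : Type u} [Field k] {α : Type v} {β : Type u} :
    (∀ (Γ : Graph α β) [Finite E(Γ)] (e : β), e ∈ E(Γ) →
      -- looping edge
      (Γ.IsLoop e →
        egf (fun m => graphClass k (Γ.parallelEdge e m)) =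
            spec (torusClass k) (expS Polynomial.X) * const (graphClass k (Γ.deleteEdges {e})) ∧
        ∀ m : ℕ, graphClass k (Γ.parallelEdge e m) =
            torusClass k ^ m * graphClass k (Γ.deleteEdges {e})) ∧
      -- bridge
      (Γ.IsBridge e →
        egf (fun m => graphClass k (Γ.parallelEdge e m)) =
            spec (torusClass k)
              (PowerSeries.C Polynomial.X * quotF + PowerSeries.X * expS Polynomial.X + 1) *
              const (graphClass k (Γ.deleteEdges {e})) ∧
        ∀ m : ℕ, graphClass k (Γ.parallelEdge e m) =
            (torusClass k * Polynomial.aeval (torusClass k) (polyF m) +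
              m * torusClass k ^ (m - 1) + (if m = 0 then 1 else 0)) *
              graphClass k (Γ.deleteEdges {e})) ∧
      -- neither a bridge nor a looping edge
      (¬ Γ.IsBridge e → ¬ Γ.IsLoop e →
        egf (fun m => graphClass k (Γ.parallelEdge e m)) =
            spec (torusClass k) quotF * const (graphClass k Γ) +
            spec (torusClass k) quotG * const (graphClass k (Γ.deleteEdges {e})) +
            spec (torusClass k) (PowerSeries.X * expS Polynomial.X - quotF) *
              const (graphClass k (Γ.contractEdge e)) ∧
        ∀ m : ℕ, graphClass k (Γ.parallelEdge e m) =
            Polynomial.aeval (torusClass k) (polyF m) * graphClass k Γ +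
            Polynomial.aeval (torusClass k) (polyG m) * graphClass k (Γ.deleteEdges {e}) +
            (m * torusClass k ^ (m - 1) - Polynomial.aeval (torusClass k) (polyF m)) *
              graphClass k (Γ.contractEdge e))) ∧
    -- banana graphs: two vertices joined by finitely many parallel edges
    (∀ (x y : α) (F : Set β) [Finite F], x ≠ y →
      graphClass k (Graph.banana x y F) =
        torusClass k * Polynomial.aeval (torusClass k) (polyF F.ncard) +
          F.ncard * torusClass k ^ (F.ncard - 1) + (if F.ncard = 0 then 1 else 0)) := by
  refine ⟨fun Γ _ e he => ⟨fun hl => ⟨?_, ?_⟩, fun hb => ⟨?_, ?_⟩, fun hb hl => ⟨?_, ?_⟩⟩,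
    fun x y F _ hxy => graphClass_banana x y F hxy⟩
  · rw [expS_X_eq_polyEgf, spec_polyEgf_mul_const]
    simp [graphClass_parallelEdge_of_isLoop Γ he hl]
  · exact graphClass_parallelEdge_of_isLoop Γ he hl
  · rw [quotF_eq_polyEgf, C_X_mul_polyEgf, X_mul_expS_X_eq_polyEgf, one_eq_polyEgf, polyEgf_add,
      polyEgf_add, spec_polyEgf_mul_const]
    refine congrArg egf (funext fun m => ?_)
    rw [graphClass_parallelEdge_of_isBridge Γ he hb]
    simp only [Pi.add_apply, map_add, map_mul, map_pow, map_natCast, Polynomial.aeval_X,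
      apply_ite (Polynomial.aeval (torusClass k)), map_one, map_zero]
    rfl
  · exact graphClass_parallelEdge_of_isBridge Γ he hb
  · rw [quotF_eq_polyEgf, quotG_eq_polyEgf, X_mul_expS_X_eq_polyEgf, polyEgf_sub,
      spec_polyEgf_mul_const, spec_polyEgf_mul_const, spec_polyEgf_mul_const, egf_add, egf_add]
    refine congrArg egf (funext fun m => ?_)
    rw [graphClass_parallelEdge_of_not_isBridge_of_not_isLoop Γ he hb hl]
    simp only [Pi.sub_apply, map_sub, map_mul, map_pow, map_natCast, Polynomial.aeval_X]
    rfl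
  · exact graphClass_parallelEdge_of_not_isBridge_of_not_isLoop Γ he hb hl
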